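/- **Theorem 4.2 (Gauge coefficient identities) and Corollary 4.3.** Let $\mathbb V=L^2((-\infty,0];\mathbb R^m)$. For $x\in\mathbb R$ and $\boldsymbol t=(t_2,t_3,\ldots)$, let $P=P(x,\boldsymbol t)$ be the semi-additive Hilbert–Schmidt operator $$(P\phi)(z)=\int_{-\infty}^0 p(z+x,\zeta+x;\boldsymbol t)\,\phi(\zeta)\,\mathrm d\zeta$$ on $\mathbb V$. Assume that for each $\boldsymbol t$ the $m\times m$ matrix function $p(\cdot,\cdot;\boldsymbol t)$ is smooth on $\mathbb R^2$, that for all $a,b\geqslant0$ and all $x$ the kernel $(\partial_1^a\partial_2^b p)(z+x,\zeta+x;\boldsymbol t)$ is square-integrable on $(-\infty,0]^2$, and that $\mathrm{id}-P(x,\boldsymbol t)$ is invertible on $\mathbb V$ for all $x,\boldsymbol t$. Put $V=(\mathrm{id}-P)^{-1}$ and let $G$ be the solution of the GLM equation $P=G(\mathrm{id}-P)$. Let $P'$ be the operator on functions on $\mathbb R$ with kernel $p(x,\xi;\boldsymbol t)$. Let $K_\pm$ be Volterra operators, $(K_-\psi)(x)=\int_{-\infty}^x\hat K_-(x,\xi)\psi(\xi)\,\mathrm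 d\xi$ and $(K_+\psi)(x)=\int_x^\infty\hat K_+(x,\xi)\psi(\xi)\,\mathrm d\xi$ (with $\hat K_-(x,\cdot)$ square-integrable on $(-\infty,x]$ and $\hat K_+(x,\cdot)$ locally integrable on $[x,\infty)$), such that $P'$ is their scattering operator, i.e. $(\mathrm{id}+K_-)(\mathrm{id}-P')=\mathrm{id}+K_+$ on $C_c^\infty(\mathbb R;\mathbb R^m)$. The gauge operator is $W=\mathrm{id}+K_-$. Its coefficients $w_k=w_k(x,\boldsymbol t)$ are those of the expansion $W=\mathrm{id}-\sum_{k\geqslant1}w_k\partial^{-k}$, where $(\partial^{-1}\psi)(x)=\int_{-\infty}^x\psi(\xi)\,\mathrm d\xi$. This expansion means that for every $N\geqslant0$ there is a Volterra operator $R_N$, $(R_N\psi)(x)=\int_{-\infty}^x r_N(x,\xi)\psi(\xi)\,\mathrm d\xi$ with $r_N(x,\cdot)$ continuous on $(-\infty,x]$, such that $W\psi=\psi-\sum_{k=1}^N w_k\,\partial^{-k}\psi+R_N\,\partial^{-N}\psi$ for all $\psi\in C_c^\infty(\mathbb R;\mathbb R^m)$. Then: 1. $G$ is Hilbert–Schmidt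 with a kernel $[\![G]\!](z,\zeta;x,\boldsymbol t)$ that is continuous in $(z,\zeta)\in(-\infty,0]^2$ and smooth in $\zeta\in(-\infty,0]$. Operators $K_\pm$ as above exist. 2. For every such pair $K_\pm$, the operator $W$ has an expansion as above, its coefficients are unique, and for all $k\geqslant1$ $$w_k(x,\boldsymbol t)=(-1)^k\,\partial_{\mathfrak r}^{k-1}[\![G]\!](0,0;x,\boldsymbol t),$$ where $\partial_{\mathfrak r}=\partial_\zeta$ (one-sided at $\zeta=0$). 3. $W=V$, in the following sense. Let $\psi:\mathbb R\to\mathbb R^m$ be continuous, and for given $x,\boldsymbol t$ suppose that $\psi_x(\zeta)=\psi(\zeta+x)$ lies in $\mathbb V$. Then $V(x,\boldsymbol t)\psi_x$ has a continuous representative on $(-\infty,0]$, and $(W\psi)(x)$ is the value of that representative at $z=0$. -/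

import Mathlib

open MeasureTheory Set
open scoped ContDiff

noncomputable section

namespace KP

/-- The Euclidean space `ℝᵐ`. -/
abbrev Vec (m : ℕ) : Type := EuclideanSpace ℝ (Fin m)

/-- Real `m × m` matrices, as linear maps of `ℝᵐ`; the product is composition. -/
abbrev Mat (m : ℕ) : Type := Vec m →L[ℝ] Vec m

/-- The infinite family of time parameters `t = (t₂, t₃, …)`. -/
abbrev Times : Type := ℕ → ℝ

/-- Lebesgue measure on the half line `(-∞, 0]`. -/
abbrev halfLine : Measure ℝ := volume.restrict (Iic (0 : ℝ))

/-- The Hilbert space `𝕍 = L²((-∞, 0]; ℝᵐ)`. -/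
abbrev HalfL2 (m : ℕ) : Type := Lp (Vec m) 2 halfLine

/-- `T` is the Hilbert-Schmidt operator on `𝕍` with the square-integrable kernel `k`:
`(T φ)(z) = ∫_{-∞}^0 k(z, ζ) φ(ζ) dζ`. -/
def HasKernel {m : ℕ} (T : HalfL2 m →L[ℝ] HalfL2 m) (k : ℝ → ℝ → Mat m) : Prop :=
  MemLp (fun q : ℝ × ℝ => k q.1 q.2) 2 (halfLine.prod halfLine) ∧
  ∀ φ : HalfL2 m, (T φ : ℝ → Vec m) =ᵐ[halfLine] fun z => ∫ ζ in Iic (0 : ℝ), k z ζ (φ ζ)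

/-- `k = ⟦T⟧`: the kernel of the Hilbert-Schmidt operator `T` is (represented by) the function
`k`, continuous on `(-∞, 0]²`. Such a `k` is unique on `(-∞, 0]²`, so point values make sense. -/
def IsBracket {m : ℕ} (T : HalfL2 m →L[ℝ] HalfL2 m) (k : ℝ → ℝ → Mat m) : Prop :=
  ContinuousOn (fun q : ℝ × ℝ => k q.1 q.2) (Iic 0 ×ˢ Iic 0) ∧ HasKernel T k

/-- The family `P(x, t)` is semi-additive with parameters `x` and `t`: it is the Hilbert-Schmidt
operator with kernel `p(z + x, ζ + x; t)`. -/
def IsSemiAdditive {m : ℕ} (P : ℝ → Times → HalfL2 m →L[ℝ] HalfL2 m)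
    (p : ℝ → ℝ → Times → Mat m) : Prop :=
  ∀ x t, HasKernel (P x t) (fun z ζ => p (z + x) (ζ + x) t)

/-- The mixed partial derivative `∂_z^a ∂_ζ^b k`. -/
def mixedDeriv {m : ℕ} (a b : ℕ) (k : ℝ → ℝ → Mat m) (z ζ : ℝ) : Mat m :=
  iteratedDeriv a (fun z' => iteratedDeriv b (fun ζ' => k z' ζ') ζ) z

/-- The scattering kernel is smooth and all left and right derivatives `∂_𝔩^a ∂_𝔯^b P` of the
semi-additive operator family are Hilbert-Schmidt, i.e. have square-integrable kernels. -/
def IsRegularKernel {m : ℕ} (p : ℝ → ℝ → Times → Mat m) : Prop :=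
  ∀ t, ContDiff ℝ ∞ (fun q : ℝ × ℝ => p q.1 q.2 t) ∧
    ∀ (a b : ℕ) (x : ℝ),
      MemLp (fun q : ℝ × ℝ => mixedDeriv a b (fun z ζ => p z ζ t) (q.1 + x) (q.2 + x)) 2
        (halfLine.prod halfLine)

/-- Smooth compactly supported `ℝᵐ`-valued functions on the line. -/
def IsTest {m : ℕ} (ψ : ℝ → Vec m) : Prop :=
  ContDiff ℝ ∞ ψ ∧ HasCompactSupport ψ

/-- The Volterra operator `(K₋ ψ)(x) = ∫_{-∞}^x k(x, ξ) ψ(ξ) dξ`. -/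
def lowerVolterra {m : ℕ} (k : ℝ → ℝ → Mat m) (ψ : ℝ → Vec m) (x : ℝ) : Vec m :=
  ∫ ξ in Iic x, k x ξ (ψ ξ)

/-- The Volterra operator `(K₊ ψ)(x) = ∫_x^∞ k(x, ξ) ψ(ξ) dξ`. -/
def upperVolterra {m : ℕ} (k : ℝ → ℝ → Mat m) (ψ : ℝ → Vec m) (x : ℝ) : Vec m :=
  ∫ ξ in Ici x, k x ξ (ψ ξ)

/-- The operator `id + K₋`. -/
def idAddLower {m : ℕ} (k : ℝ → ℝ → Mat m) (ψ : ℝ → Vec m) (x : ℝ) : Vec m :=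
  ψ x + lowerVolterra k ψ x

/-- The operator `id + K₊`. -/
def idAddUpper {m : ℕ} (k : ℝ → ℝ → Mat m) (ψ : ℝ → Vec m) (x : ℝ) : Vec m :=
  ψ x + upperVolterra k ψ x

/-- The operator `id - P'` on functions on the line, where `P'` has the kernel `p'(x, ξ)`. -/
def idSubFull {m : ℕ} (p' : ℝ → ℝ → Mat m) (ψ : ℝ → Vec m) (x : ℝ) : Vec m :=
  ψ x - ∫ ξ, p' x ξ (ψ ξ)

/-- The operator `P'` with kernel `p'` is the scattering operator of the pair of Volterra operators
`K₋, K₊` with kernels `kminus, kplus`, i.e. `id - P' = (id + K₋)⁻¹ (id + K₊)`, in the form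
`(id + K₋) (id - P') = id + K₊` on test functions. The rows of `kminus` are
square-integrable and those of `kplus` are locally integrable, which makes all
the integrals below converge for square-integrable scattering data. -/
def IsScatteringFactorization {m : ℕ} (p' kminus kplus : ℝ → ℝ → Mat m) : Prop :=
  (∀ x, MemLp (kminus x) 2 (volume.restrict (Iic x))) ∧
  (∀ x, LocallyIntegrableOn (kplus x) (Ici x)) ∧
  ∀ ψ : ℝ → Vec m, IsTest ψ → ∀ x,
    idAddLower kminus (idSubFull p' ψ) x = idAddUpper kplus ψ x

/-- The gauge operator `W = id + K₋`. -/
def gaugeOperator {m : ℕ} (kminus : ℝ → ℝ → Mat m) : (ℝ → Vec m) → ℝ → Vec m :=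
  idAddLower kminus

/-- `(∂⁻¹ ψ)(x) = ∫_{-∞}^x ψ(ξ) dξ`. -/
def invDeriv {m : ℕ} (ψ : ℝ → Vec m) (x : ℝ) : Vec m := ∫ ξ in Iic x, ψ ξ

/-- The `w_k`, `k ≥ 1`, are the coefficients in the pseudo-differential expansion
`W = id - ∑_{k ≥ 1} w_k ∂^{-k}`: for every `N`, `W` is the truncation of the series after the `N`-th
term plus a remainder `R_N ∂^{-N}`, where `R_N` is a Volterra integral operator
with kernel `r(x, ·)` continuous on `(-∞, x]`. -/
def HasGaugeExpansion {m : ℕ} (W : (ℝ → Vec m) → ℝ → Vec m) (w : ℕ → ℝ → Mat m) : Prop :=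
  ∀ N : ℕ, ∃ r : ℝ → ℝ → Mat m, (∀ x, ContinuousOn (r x) (Iic x)) ∧
    ∀ ψ : ℝ → Vec m, IsTest ψ → ∀ x,
      W ψ x = ψ x - ∑ k ∈ Finset.Icc 1 N, w k x (invDeriv^[k] ψ x)
        + lowerVolterra r (invDeriv^[N] ψ) x

/-- The right derivative `∂_𝔯^j k (z, ζ) = ∂_ζ^j k (z, ζ)` of a kernel on `(-∞, 0]²`
(one-sided at `ζ = 0`). -/
def rightDeriv {m : ℕ} (j : ℕ) (k : ℝ → ℝ → Mat m) (z ζ : ℝ) : Mat m :=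
  iteratedDerivWithin j (fun ζ' => k z ζ') (Iic 0) ζ

/-- `V = (id - P)⁻¹`, for invertible `id - P`. -/
def resolventOp {m : ℕ} (P : HalfL2 m →L[ℝ] HalfL2 m) : HalfL2 m →L[ℝ] HalfL2 m :=
  Ring.inverse (1 - P)

end KP

end

/-! Fix `x`, `t`, write `q z ζ = p (z + x) (ζ + x) t` and `V = (id - P)⁻¹`. Everything rests on one
functional on `𝕍`, `resolventRow`: apply `V`, then pair with the row `q z`. Since `G = P V`, its
value on `φ` is `(G φ)(z)`. Since `V = id + V P` and `P φ` superposes the columns `q(·, s)`, it is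
integration against `q z s` plus its own value on the column `q(·, s)` (`resolventRow_apply`). This
is `glmKernel`, which makes sense for all real `s`. It is smooth in `s` because `s ↦ q(·, s)` is
smooth as an `L²`-valued map (`contDiff_column`).

The scattering equation at `x`, tested on functions supported to the left of `x`, does not see `K₊`.
It says that the translated row of `K₋`, composed with `id - P`, is the row `q 0`. Invertibility
forces this row to be the resolvent row at `z = 0` (`rowPairing_eq_resolventRow`). So `K₋` has the
kernel `⟦G⟧(0, ξ - x)`; conversely this kernel, with minus its extension to `ξ > x` for `K₊`, solves
the equation (`factorization_glmKernel`).

Repeated integration by parts of `K₋` produces the coefficients as derivatives on the diagonal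
(`integral_expansion`), and concentrated test functions show that no others are possible
(`coeff_unique`). Finally `V = id + P V` gives `V φ` the continuous representative `φ(z)` plus the
resolvent row at `z`, which at `z = 0` is `W`. -/

noncomputable section

namespace KP

/-! ### Smooth kernels as smooth families of `L²` columns -/

section Columns

variable {E : Type*} [NormedAddCommGroup E] [NormedSpace ℝ E]

/-- The `b`-th partial derivative of `f` in the second variable. -/
abbrev colDeriv (b : ℕ) (f : ℝ → ℝ → E) (η s : ℝ) : E := iteratedDeriv b (f η) s

/-- `f` is smooth and its derivatives in the second variable are square-integrable on
`(-∞, 0] × (-∞, y]` for every `y`. -/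
structure HasL2Columns (f : ℝ → ℝ → E) : Prop where
  contDiff : ContDiff ℝ ∞ (fun q : ℝ × ℝ => f q.1 q.2)
  memLp_prod : ∀ (b : ℕ) (y : ℝ),
    MemLp (fun q : ℝ × ℝ => colDeriv b f q.1 q.2) 2 (halfLine.prod (volume.restrict (Iic y)))

/-- Jensen's inequality for the square, applied fibrewise, followed by Fubini. -/
lemma memLp_integral_right {α β : Type*} [MeasurableSpace α] [MeasurableSpace β]
    {μ : Measure α} {ν : Measure β} [SFinite μ] [IsProbabilityMeasure ν] {F : α × β → ℝ}
    (hF : MemLp F 2 (μ.prod ν)) : MemLp (fun a => ∫ b, F (a, b) ∂ν) 2 μ := by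
  have hm : AEStronglyMeasurable (fun a => ∫ b, F (a, b) ∂ν) μ :=
    hF.aestronglyMeasurable.integral_prod_right'
  have h2 : Integrable (fun q => F q ^ 2) (μ.prod ν) := hF.integrable_sq
  rw [memLp_two_iff_integrable_sq hm]
  refine h2.integral_prod_left.mono' (hm.pow 2) ?_
  filter_upwards [h2.prod_right_ae, hF.aestronglyMeasurable.prodMk_left] with a ha ham
  rw [Real.norm_of_nonneg (sq_nonneg _)]
  have hL2 : MemLp (fun b => F (a, b)) 2 ν := (memLp_two_iff_integrable_sq ham).2 ha
  exact (even_two.convexOn_pow (𝕜 := ℝ)).map_integral_le (by fun_prop) isClosed_univ (by simp)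
    (hL2.integrable one_le_two) ha

namespace HasL2Columns

variable {f : ℝ → ℝ → E}

lemma contDiff_colDeriv (h : ContDiff ℝ ∞ (fun q : ℝ × ℝ => f q.1 q.2)) (b : ℕ) :
    ContDiff ℝ ∞ (fun q : ℝ × ℝ => colDeriv b f q.1 q.2) := by
  induction b with
  | zero => simpa [colDeriv] using h
  | succ b ih =>
    have key : (fun q : ℝ × ℝ => colDeriv (b + 1) f q.1 q.2) = fun q : ℝ × ℝ =>
        fderiv ℝ (fun q : ℝ × ℝ => colDeriv b f q.1 q.2) q (0, 1) := by
      funext q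
      have h1 : HasFDerivAt (fun q : ℝ × ℝ => colDeriv b f q.1 q.2) _ (q.1, q.2) :=
        (ih.differentiable (by simp) q).hasFDerivAt
      have h2 : HasDerivAt (fun s : ℝ => ((q.1, s) : ℝ × ℝ)) (0, 1) q.2 :=
        (hasDerivAt_const _ _).prodMk (hasDerivAt_id _)
      have h3 := h1.comp_hasDerivAt q.2 h2
      simp only [colDeriv, iteratedDeriv_succ]
      exact h3.deriv
    rw [key]
    exact (ih.fderiv_right (m := ∞) (by simp)).clm_apply contDiff_const

lemma contDiff_row (h : ContDiff ℝ ∞ (fun q : ℝ × ℝ => f q.1 q.2)) (η : ℝ) :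
    ContDiff ℝ ∞ (f η) :=
  h.comp (contDiff_const.prodMk contDiff_id : ContDiff ℝ ∞ fun s : ℝ => ((η, s) : ℝ × ℝ))

lemma hasDerivAt_colDeriv (h : HasL2Columns f) (b : ℕ) (η s : ℝ) :
    HasDerivAt (colDeriv b f η) (colDeriv (b + 1) f η s) s := by
  rw [colDeriv, iteratedDeriv_succ]
  exact ((contDiff_row h.contDiff η).differentiable_iteratedDeriv b
    (by exact_mod_cast WithTop.coe_lt_top _) s).hasDerivAt

lemma continuous_colDeriv (h : HasL2Columns f) (b : ℕ) :
    Continuous (fun q : ℝ × ℝ => colDeriv b f q.1 q.2) :=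
  (contDiff_colDeriv h.contDiff b).continuous

/-- One-dimensional Sobolev embedding on an interval of length one: the supremum is at most the mean
of the function plus the mean of its derivative. Both means are square-integrable in `η`, so one
`L²` function dominates all columns with `s` in the interval. -/
lemma exists_bound [CompleteSpace E] (h : HasL2Columns f) (b : ℕ) (a : ℝ) :
    ∃ B : ℝ → ℝ, MemLp B 2 halfLine ∧
      ∀ η, ∀ s ∈ Icc a (a + 1), ‖colDeriv b f η s‖ ≤ B η := by
  let ν : Measure ℝ := volume.restrict (Ioc a (a + 1))
  have hν : IsProbabilityMeasure ν := ⟨by simp [ν]⟩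
  have hmono : halfLine.prod ν ≤ halfLine.prod (volume.restrict (Iic (a + 1))) :=
    Measure.prod_mono le_rfl (Measure.restrict_mono Ioc_subset_Iic_self le_rfl)
  refine ⟨fun η => ∫ s, (‖colDeriv b f η s‖ + ‖colDeriv (b + 1) f η s‖) ∂ν,
    memLp_integral_right (F := fun q => ‖colDeriv b f q.1 q.2‖ + ‖colDeriv (b + 1) f q.1 q.2‖)
      ((((h.memLp_prod b (a + 1)).mono_measure hmono).norm).add
        (((h.memLp_prod (b + 1) (a + 1)).mono_measure hmono).norm)), fun η s hs => ?_⟩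
  have hc : ∀ b, Continuous (colDeriv b f η) := fun b =>
    (h.continuous_colDeriv b).comp (by fun_prop : Continuous fun s : ℝ => ((η, s) : ℝ × ℝ))
  have hi : ∀ b, IntegrableOn (fun s => ‖colDeriv b f η s‖) (Ioc a (a + 1)) := fun b =>
    ((hc b).norm.integrableOn_Icc).mono_set Ioc_subset_Icc_self
  have hpt : ∀ u ∈ Ioc a (a + 1), ‖colDeriv b f η s‖ ≤ ‖colDeriv b f η u‖ +
      ∫ v in Ioc a (a + 1), ‖colDeriv (b + 1) f η v‖ := by
    intro u hu
    have hftc : ∫ v in u..s, colDeriv (b + 1) f η v = colDeriv b f η s - colDeriv b f η u :=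
      intervalIntegral.integral_eq_sub_of_hasDerivAt
        (fun v _ => h.hasDerivAt_colDeriv b η v) ((hc _).intervalIntegrable _ _)
    have h1 : ‖∫ v in u..s, colDeriv (b + 1) f η v‖ ≤
        ∫ v in Ioc a (a + 1), ‖colDeriv (b + 1) f η v‖ := by
      refine (intervalIntegral.norm_integral_le_integral_norm_uIoc).trans ?_
      refine setIntegral_mono_set (hi _) (Filter.Eventually.of_forall fun _ => norm_nonneg _) ?_
      exact (Ioc_subset_Ioc (le_min hu.1.le hs.1) (max_le hu.2 hs.2)).eventuallyLE
    rw [hftc] at h1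
    linarith [norm_sub_norm_le (colDeriv b f η s) (colDeriv b f η u)]
  have h2 := setIntegral_mono_on (integrableOn_const (C := ‖colDeriv b f η s‖) (by simp))
    ((hi b).add (integrableOn_const (C := ∫ v in Ioc a (a + 1), ‖colDeriv (b + 1) f η v‖)
      (by simp))) measurableSet_Ioc hpt
  have h3 := integral_add (hi b)
    (integrableOn_const (C := ∫ v in Ioc a (a + 1), ‖colDeriv (b + 1) f η v‖)
      (μ := volume) (s := Ioc a (a + 1)) (by simp))
  have h4 := integral_add (hi b) (hi (b + 1))
  simp only [setIntegral_const, Pi.add_apply] at h2 h3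
  simp only [ν]
  rw [h4]
  simp only [measureReal_def, Real.volume_Ioc, add_sub_cancel_left, ENNReal.ofReal_one,
    ENNReal.toReal_one, one_smul] at h2 h3
  linarith

lemma memLp_column [CompleteSpace E] (h : HasL2Columns f) (b : ℕ) (s : ℝ) :
    MemLp (fun η => colDeriv b f η s) 2 halfLine := by
  obtain ⟨B, hB, hle⟩ := h.exists_bound b s
  exact hB.mono' ((h.continuous_colDeriv b).comp
    (by fun_prop : Continuous fun η : ℝ => ((η, s) : ℝ × ℝ))).aestronglyMeasurable
    (Filter.Eventually.of_forall fun η => hle η s ⟨le_rfl, by linarith⟩)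

/-- The column `∂_s^b f(·, s)` as an element of `L²((-∞, 0])`. -/
def column [CompleteSpace E] (h : HasL2Columns f) (b : ℕ) (s : ℝ) : Lp E 2 halfLine :=
  (h.memLp_column b s).toLp

lemma coeFn_column [CompleteSpace E] (h : HasL2Columns f) (b : ℕ) (s : ℝ) :
    h.column b s =ᵐ[halfLine] fun η => colDeriv b f η s :=
  MemLp.coeFn_toLp _

/-- Mean value inequality twice; the sharp factor `1/2` is not needed. -/
lemma taylor_bound (h : HasL2Columns f) (b : ℕ) (η : ℝ) {a B s u : ℝ}
    (hB : ∀ s ∈ Icc a (a + 1), ‖colDeriv (b + 2) f η s‖ ≤ B)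
    (hs : s ∈ Icc a (a + 1)) (hu : u ∈ Icc a (a + 1)) :
    ‖colDeriv b f η u - colDeriv b f η s - (u - s) • colDeriv (b + 1) f η s‖ ≤
      B * ‖u - s‖ ^ 2 := by
  have h1 : ∀ v ∈ Icc a (a + 1),
      ‖colDeriv (b + 1) f η v - colDeriv (b + 1) f η s‖ ≤ B * ‖v - s‖ := fun v hv =>
    (convex_Icc a (a + 1)).norm_image_sub_le_of_norm_hasDerivWithin_le
      (fun w _ => (h.hasDerivAt_colDeriv (b + 1) η w).hasDerivWithinAt) hB hs hv
  have hB0 : 0 ≤ B := (norm_nonneg _).trans (hB s hs)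
  have hsub : uIcc s u ⊆ Icc a (a + 1) := uIcc_subset_Icc hs hu
  have h2 := (convex_uIcc s u).norm_image_sub_le_of_norm_hasDerivWithin_le
    (f := fun w => colDeriv b f η w - w • colDeriv (b + 1) f η s) (C := B * ‖u - s‖)
    (fun w _ => ((h.hasDerivAt_colDeriv b η w).sub
      ((hasDerivAt_id w).smul_const (colDeriv (b + 1) f η s))).hasDerivWithinAt)
    (fun w hw => by
      rw [one_smul]
      refine (h1 w (hsub hw)).trans ?_
      have : ‖w - s‖ ≤ ‖u - s‖ := by
        simpa [Real.norm_eq_abs] using abs_sub_left_of_mem_uIcc hw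
      gcongr) left_mem_uIcc right_mem_uIcc
  calc _ = ‖colDeriv b f η u - u • colDeriv (b + 1) f η s -
        (colDeriv b f η s - s • colDeriv (b + 1) f η s)‖ := by
          congr 1; rw [sub_smul]; abel
    _ ≤ _ := h2
    _ = _ := by ring

/-- The pointwise Taylor remainder is at most `B η * (u - s) ^ 2` with `B` in `L²`, so the
difference quotients converge in `L²` norm. -/
lemma hasDerivAt_column [CompleteSpace E] (h : HasL2Columns f) (b : ℕ) (s : ℝ) :
    HasDerivAt (h.column b) (h.column (b + 1) s) s := by
  -- Starting at `s - 1 / 2` centres the unit interval at `s`, so it is a neighbourhood of `s`.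
  obtain ⟨B, hB, hle⟩ := h.exists_bound (b + 2) (s - 1 / 2)
  rw [hasDerivAt_iff_isLittleO]
  have hO : (fun u => h.column b u - h.column b s - (u - s) • h.column (b + 1) s)
      =O[nhds s] fun u => (u - s) ^ 2 := by
    refine Asymptotics.IsBigO.of_bound ‖hB.toLp‖ ?_
    filter_upwards [Icc_mem_nhds (by linarith : s - 1 / 2 < s)
      (by linarith : s < s - 1 / 2 + 1)] with u hu
    rw [mul_comm, norm_pow]
    refine Lp.norm_le_mul_norm_of_ae_le_mul ?_
    filter_upwards [Lp.coeFn_sub (h.column b u - h.column b s) ((u - s) • h.column (b + 1) s),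
      Lp.coeFn_sub (h.column b u) (h.column b s), Lp.coeFn_smul (u - s) (h.column (b + 1) s),
      h.coeFn_column b u, h.coeFn_column b s, h.coeFn_column (b + 1) s, hB.coeFn_toLp]
      with η e1 e2 e3 e4 e5 e6 e7
    rw [e1, Pi.sub_apply, e2, e3, Pi.sub_apply, Pi.smul_apply, e4, e5, e6, e7]
    refine (h.taylor_bound b η (hle η) ⟨by linarith, by linarith⟩ hu).trans ?_
    rw [mul_comm]
    gcongr
    exact le_abs_self _
  refine hO.trans_isLittleO ?_
  have := (Asymptotics.isLittleO_pow_id (𝕜 := ℝ) one_lt_two).comp_tendsto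
    (tendsto_sub_nhds_zero_iff.2 (Filter.tendsto_id (x := nhds s)))
  simpa [Function.comp_def] using this

lemma contDiff_column [CompleteSpace E] (h : HasL2Columns f) (b : ℕ) :
    ContDiff ℝ ∞ (h.column b) := by
  rw [contDiff_infty]
  intro n
  induction n generalizing b with
  | zero =>
    exact contDiff_zero.2 (continuous_iff_continuousAt.2 fun s =>
      (h.hasDerivAt_column b s).continuousAt)
  | succ n ih =>
    have : deriv (h.column b) = h.column (b + 1) := funext fun s => (h.hasDerivAt_column b s).deriv
    push_cast
    rw [contDiff_succ_iff_deriv]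
    exact ⟨fun s => (h.hasDerivAt_column b s).differentiableAt, by simp, this ▸ ih (b + 1)⟩

lemma memLp_norm_column [CompleteSpace E] (h : HasL2Columns f) (y : ℝ) :
    MemLp (fun s => ‖h.column 0 s‖) 2 (volume.restrict (Iic y)) := by
  have hm : AEStronglyMeasurable (fun s => ‖h.column 0 s‖) (volume.restrict (Iic y)) :=
    (h.contDiff_column 0).continuous.norm.aestronglyMeasurable
  rw [memLp_two_iff_integrable_sq hm]
  have h0 := h.memLp_prod 0 y
  have h1 : Integrable (fun q : ℝ × ℝ => ‖colDeriv 0 f q.1 q.2‖ ^ 2)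
    (halfLine.prod (volume.restrict (Iic y))) := h0.norm.integrable_sq
  refine h1.integral_prod_right.congr (Filter.Eventually.of_forall fun s => ?_)
  have h2 : MemLp (fun η => colDeriv 0 f η s) 2 halfLine := h.memLp_column 0 s
  simp only [column, Lp.norm_toLp]
  have h3 := h2.eLpNorm_eq_integral_rpow_norm (by simp) (by simp)
  rw [h3, ENNReal.toReal_ofReal (by positivity)]
  simp only [ENNReal.toReal_ofNat, Real.rpow_two]
  rw [← Real.rpow_natCast, ← Real.rpow_mul (by positivity)]
  norm_num

end HasL2Columns

end Columns

end KP

/-! ### Resolvent rows and the kernel of `G` -/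

namespace KP

open scoped RealInnerProductSpace

variable {m : ℕ}

/-- The functional `φ ↦ ∫ k(ζ) φ(ζ) dζ` on `𝕍` given by a square-integrable row `k`. -/
def rowPairing : Lp (Mat m) 2 halfLine →L[ℝ] (HalfL2 m →L[ℝ] Vec m) :=
  (ContinuousLinearMap.id ℝ (Mat m)).lpPairing halfLine 2 2

lemma rowPairing_eq_integral {k : ℝ → Mat m} {K : Lp (Mat m) 2 halfLine}
    (hk : K =ᵐ[halfLine] k) (φ : HalfL2 m) :
    rowPairing K φ = ∫ ζ in Iic (0 : ℝ), k ζ (φ ζ) := by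
  rw [rowPairing, ContinuousLinearMap.lpPairing_eq_integral]
  refine integral_congr_ae ?_
  filter_upwards [hk] with ζ hζ
  simp [hζ]

/-- The operator `v ↦ c(·) v` from `ℝᵐ` to `𝕍` given by a square-integrable column `c`. -/
def columnMap : Lp (Mat m) 2 halfLine →L[ℝ] (Vec m →L[ℝ] HalfL2 m) :=
  ((ContinuousLinearMap.id ℝ (Mat m)).flip.compLpL₂ 2 halfLine).flip

lemma coeFn_columnMap (c : Lp (Mat m) 2 halfLine) (v : Vec m) :
    columnMap c v =ᵐ[halfLine] fun η => c η v := by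
  have := ((ContinuousLinearMap.id ℝ (Mat m)).flip v).coeFn_compLpL (p := 2) c
  exact this

lemma integrable_apply {α : Type*} [MeasurableSpace α] {μ : Measure α} {F : α → Mat m}
    {φ : α → Vec m} (hF : MemLp F 2 μ) (hφ : MemLp φ 2 μ) : Integrable (fun a => F a (φ a)) μ :=
  memLp_one_iff_integrable.1
    ((ContinuousLinearMap.id ℝ (Mat m)).memLp_of_bilin (r := 1) hF hφ)

lemma memLp_fun_add {α E : Type*} [MeasurableSpace α] {μ : Measure α} [NormedAddCommGroup E]
    {f g : α → E} (hf : MemLp f 2 μ) (hg : MemLp g 2 μ) : MemLp (fun a => f a + g a) 2 μ :=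
  hf.add hg

lemma memLp_mul_prod {μ ν : Measure ℝ} [SFinite μ] [SFinite ν] {a b : ℝ → ℝ}
    (ha : MemLp a 2 μ) (hb : MemLp b 2 ν) :
    MemLp (fun q : ℝ × ℝ => a q.1 * b q.2) 2 (μ.prod ν) := by
  have hm : AEStronglyMeasurable (fun q : ℝ × ℝ => a q.1 * b q.2) (μ.prod ν) :=
    ha.aestronglyMeasurable.comp_fst.mul hb.aestronglyMeasurable.comp_snd
  rw [memLp_two_iff_integrable_sq hm]
  simp only [mul_pow]
  exact ha.integrable_sq.mul_prod hb.integrable_sq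

/-- Cauchy–Schwarz in `s` for almost every `η`, then integration in `η`. -/
lemma memLp_kernel_integral {ν : Measure ℝ} [SFinite ν] {F : ℝ × ℝ → Mat m} {φ : ℝ → Vec m}
    (hF : MemLp F 2 (halfLine.prod ν)) (hφ : MemLp φ 2 ν) :
    MemLp (fun η => ∫ s, F (η, s) (φ s) ∂ν) 2 halfLine := by
  have hFn : Integrable (fun q => ‖F q‖ ^ 2) (halfLine.prod ν) := hF.norm.integrable_sq
  have hmF : AEStronglyMeasurable (fun q : ℝ × ℝ => F q (φ q.2)) (halfLine.prod ν) :=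
    (ContinuousLinearMap.id ℝ (Mat m)).aestronglyMeasurable_comp₂ hF.aestronglyMeasurable
      hφ.aestronglyMeasurable.comp_snd
  have hm : AEStronglyMeasurable (fun η => ∫ s, F (η, s) (φ s) ∂ν) halfLine :=
    hmF.integral_prod_right'
  rw [memLp_two_iff_integrable_sq_norm hm]
  refine (hFn.integral_prod_left.mul_const (∫ s, ‖φ s‖ ^ 2 ∂ν)).mono' (hm.norm.pow 2) ?_
  filter_upwards [hFn.prod_right_ae, hF.aestronglyMeasurable.prodMk_left] with η hη hηm
  have hL2 : MemLp (fun s => F (η, s)) 2 ν := (memLp_two_iff_integrable_sq_norm hηm).2 hη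
  have hHolder := integral_mul_norm_le_Lp_mul_Lq (μ := ν) Real.HolderConjugate.two_two
    (f := fun s => ‖F (η, s)‖) (g := fun s => ‖φ s‖) (by simpa using hL2.norm)
    (by simpa using hφ.norm)
  simp only [norm_norm, Real.rpow_two] at hHolder
  have hle : ‖∫ s, F (η, s) (φ s) ∂ν‖ ≤ ∫ s, ‖F (η, s)‖ * ‖φ s‖ ∂ν :=
    norm_integral_le_of_norm_le (hL2.norm.integrable_mul hφ.norm)
      (Filter.Eventually.of_forall fun s => (F (η, s)).le_opNorm _)
  have hA : 0 ≤ ∫ s, ‖F (η, s)‖ ^ 2 ∂ν := by positivity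
  have hB : 0 ≤ ∫ s, ‖φ s‖ ^ 2 ∂ν := by positivity
  rw [Real.norm_of_nonneg (by positivity)]
  calc _ ≤ ((∫ s, ‖F (η, s)‖ ^ 2 ∂ν) ^ (1 / 2 : ℝ) * (∫ s, ‖φ s‖ ^ 2 ∂ν) ^ (1 / 2 : ℝ)) ^ 2 := by
        gcongr
        exact hle.trans hHolder
    _ = _ := by
        rw [mul_pow, ← Real.sqrt_eq_rpow, ← Real.sqrt_eq_rpow, Real.sq_sqrt hA, Real.sq_sqrt hB]

/-- Fubini, justified because the integrand is bounded by the product of the `L²` functions `‖f‖`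
and `‖χ‖ ⊗ ‖φ‖`. -/
lemma inner_kernel_integral {f : ℝ → ℝ → Mat m} (h : HasL2Columns f) {y : ℝ} {φ : ℝ → Vec m}
    (hφ : MemLp φ 2 (volume.restrict (Iic y))) {Φ : HalfL2 m}
    (hΦ : Φ =ᵐ[halfLine] fun η => ∫ s in Iic y, f η s (φ s)) (χ : HalfL2 m) :
    ⟪χ, Φ⟫ = ∫ s in Iic y, ⟪χ, columnMap (h.column 0 s) (φ s)⟫ := by
  have hf : MemLp (fun q : ℝ × ℝ => f q.1 q.2) 2 (halfLine.prod (volume.restrict (Iic y))) :=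
    h.memLp_prod 0 y
  have hχ : MemLp χ 2 halfLine := Lp.memLp χ
  have hfn : Integrable (fun q : ℝ × ℝ => ‖f q.1 q.2‖ ^ 2)
    (halfLine.prod (volume.restrict (Iic y))) := hf.norm.integrable_sq
  have hprod : MemLp (fun q : ℝ × ℝ => ‖χ q.1‖ * ‖φ q.2‖) 2
      (halfLine.prod (volume.restrict (Iic y))) := memLp_mul_prod hχ.norm hφ.norm
  have hint : Integrable (fun q : ℝ × ℝ => ⟪χ q.1, f q.1 q.2 (φ q.2)⟫)
      (halfLine.prod (volume.restrict (Iic y))) := by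
    refine (hf.norm.integrable_mul hprod).mono' ?_ (Filter.Eventually.of_forall fun q => ?_)
    · exact hχ.aestronglyMeasurable.comp_fst.inner
        ((ContinuousLinearMap.id ℝ (Mat m)).aestronglyMeasurable_comp₂ hf.aestronglyMeasurable
          hφ.aestronglyMeasurable.comp_snd)
    · calc _ ≤ ‖χ q.1‖ * ‖f q.1 q.2 (φ q.2)‖ := norm_inner_le_norm _ _
        _ ≤ ‖χ q.1‖ * (‖f q.1 q.2‖ * ‖φ q.2‖) := by
          gcongr; exact ContinuousLinearMap.le_opNorm _ _
        _ = ‖f q.1 q.2‖ * (‖χ q.1‖ * ‖φ q.2‖) := by ring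
  calc ⟪χ, Φ⟫ = ∫ η in Iic 0, ∫ s in Iic y, ⟪χ η, f η s (φ s)⟫ := by
        rw [L2.inner_def]
        refine integral_congr_ae ?_
        filter_upwards [hΦ, hfn.prod_right_ae, hf.aestronglyMeasurable.prodMk_left]
          with η h1 h2 h3
        rw [h1, ← integral_inner]
        exact integrable_apply ((memLp_two_iff_integrable_sq_norm h3).2 h2) hφ
    _ = ∫ s in Iic y, ∫ η in Iic 0, ⟪χ η, f η s (φ s)⟫ := integral_integral_swap hint
    _ = _ := by
        refine integral_congr_ae (Filter.Eventually.of_forall fun s => ?_)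
        simp only [L2.inner_def]
        refine integral_congr_ae ?_
        filter_upwards [coeFn_columnMap (h.column 0 s) (φ s), h.coeFn_column 0 s] with η h1 h2
        simp [h1, h2, colDeriv]

lemma continuous_comp_column {f : ℝ → ℝ → Mat m} (h : HasL2Columns f)
    (L : HalfL2 m →L[ℝ] Vec m) : Continuous fun s => L ∘L columnMap (h.column 0 s) := by
  have := (h.contDiff_column 0).continuous
  fun_prop

lemma memLp_comp_column {f : ℝ → ℝ → Mat m} (h : HasL2Columns f)
    (L : HalfL2 m →L[ℝ] Vec m) (y : ℝ) :
    MemLp (fun s => L ∘L columnMap (h.column 0 s)) 2 (volume.restrict (Iic y)) := by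
  refine ((h.memLp_norm_column y).const_mul (‖L‖ * ‖columnMap (m := m)‖)).mono'
    (continuous_comp_column h L).aestronglyMeasurable (Filter.Eventually.of_forall fun s => ?_)
  refine (L.opNorm_comp_le _).trans ?_
  rw [mul_assoc]
  gcongr
  exact columnMap.le_opNorm _

/-- Bounded functionals pass under the integral over columns. Testing against `w` and moving `L` to
its adjoint reduces this to the scalar case, with no `𝕍`-valued integral. -/
lemma functional_kernel_integral {f : ℝ → ℝ → Mat m} (h : HasL2Columns f) {y : ℝ}
    {φ : ℝ → Vec m} (hφ : MemLp φ 2 (volume.restrict (Iic y))) {Φ : HalfL2 m}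
    (hΦ : Φ =ᵐ[halfLine] fun η => ∫ s in Iic y, f η s (φ s)) (L : HalfL2 m →L[ℝ] Vec m) :
    L Φ = ∫ s in Iic y, (L ∘L columnMap (h.column 0 s)) (φ s) := by
  have hi := integrable_apply (memLp_comp_column h L y) hφ
  refine ext_inner_left ℝ fun w => ?_
  rw [← integral_inner hi]
  have hadj : ∀ v, ⟪w, L v⟫ = ⟪L.adjoint w, v⟫ := fun v => (L.adjoint_inner_left v w).symm
  simp only [ContinuousLinearMap.comp_apply, hadj]
  exact inner_kernel_integral h hφ hΦ _

/-- A smooth kernel all of whose pure partial derivatives are square-integrable. -/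
structure IsRegularSlice (q : ℝ → ℝ → Mat m) : Prop where
  cols : HasL2Columns q
  rows : HasL2Columns fun s z => q z s

namespace IsRegularSlice

variable {q : ℝ → ℝ → Mat m} (h : IsRegularSlice q) (P : HalfL2 m →L[ℝ] HalfL2 m)

/-- The functional taking `φ` to the value at `z` of `P (id - P)⁻¹ φ`. -/
def resolventRow (z : ℝ) : HalfL2 m →L[ℝ] Vec m :=
  rowPairing (h.rows.column 0 z) ∘L resolventOp P

/-- The continuous kernel of `G = P (id - P)⁻¹`, extended to the plane. -/
def glmKernel (z s : ℝ) : Mat m :=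
  q z s + h.resolventRow P z ∘L columnMap (h.cols.column 0 s)

lemma continuous_glmKernel : Continuous fun r : ℝ × ℝ => h.glmKernel P r.1 r.2 := by
  have h1 := (h.rows.contDiff_column 0).continuous
  have h2 := (h.cols.contDiff_column 0).continuous
  have h3 := h.cols.contDiff.continuous
  unfold glmKernel resolventRow
  refine h3.add ?_
  fun_prop

lemma contDiff_glmKernel (z : ℝ) : ContDiff ℝ ∞ (h.glmKernel P z) := by
  have h2 := h.cols.contDiff_column 0
  have h3 := HasL2Columns.contDiff_row h.cols.contDiff z
  unfold glmKernel
  refine h3.add ?_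
  exact contDiff_const.clm_comp (columnMap.contDiff.comp h2)

include h in
lemma memLp_row (z : ℝ) : MemLp (q z) 2 halfLine := h.rows.memLp_column 0 z

lemma memLp_glmKernel_row (z : ℝ) : MemLp (h.glmKernel P z) 2 halfLine := by
  unfold glmKernel
  exact memLp_fun_add (h.memLp_row z) (memLp_comp_column h.cols _ 0)

lemma rowPairing_row (z : ℝ) (φ : HalfL2 m) :
    rowPairing (h.rows.column 0 z) φ = ∫ ζ in Iic (0 : ℝ), q z ζ (φ ζ) :=
  rowPairing_eq_integral (h.rows.coeFn_column 0 z) φ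

variable {P} (hP : HasKernel P q) (hinv : IsUnit (1 - P))

include hP hinv in
-- The order `V = id + V P` matters: `P` then acts first, so `P φ` can be expanded in the columns of
-- `q` and the functional moved inside the integral.
lemma resolventRow_apply (z : ℝ) (φ : HalfL2 m) :
    h.resolventRow P z φ = ∫ s in Iic (0 : ℝ), h.glmKernel P z s (φ s) := by
  have hφ : MemLp φ 2 halfLine := Lp.memLp φ
  have hV : resolventOp P φ = φ + resolventOp P (P φ) := by
    have := congrArg (fun T : HalfL2 m →L[ℝ] HalfL2 m => T φ) (Ring.inverse_mul_cancel _ hinv)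
    simp only [mul_apply_eq_comp, sub_apply, one_apply_eq_self, map_sub] at this
    exact sub_eq_iff_eq_add.1 this
  have h1 : h.resolventRow P z φ =
      rowPairing (h.rows.column 0 z) φ + h.resolventRow P z (P φ) := by
    simp only [resolventRow, ContinuousLinearMap.comp_apply]
    rw [hV, map_add]
  rw [h1, h.rowPairing_row, functional_kernel_integral h.cols hφ (hP.2 φ),
    ← integral_add (integrable_apply (h.memLp_row z) hφ)
      (integrable_apply (memLp_comp_column h.cols _ 0) hφ)]
  rfl

lemma memLp_resolventRow_comp_column : MemLp (fun r : ℝ × ℝ =>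
    h.resolventRow P r.1 ∘L columnMap (h.cols.column 0 r.2)) 2 (halfLine.prod halfLine) := by
  have h1 := (h.rows.contDiff_column 0).continuous
  have h2 := (h.cols.contDiff_column 0).continuous
  have hm : Continuous (fun r : ℝ × ℝ =>
      h.resolventRow P r.1 ∘L columnMap (h.cols.column 0 r.2)) := by
    unfold resolventRow
    fun_prop
  refine ((memLp_mul_prod (h.rows.memLp_norm_column 0) (h.cols.memLp_norm_column 0)).const_mul
    (‖rowPairing (m := m)‖ * ‖resolventOp P‖ * ‖columnMap (m := m)‖)).mono'
    hm.aestronglyMeasurable (Filter.Eventually.of_forall fun r => ?_)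
  calc _ ≤ (‖rowPairing (m := m)‖ * ‖h.rows.column 0 r.1‖) * ‖resolventOp P‖ *
        (‖columnMap (m := m)‖ * ‖h.cols.column 0 r.2‖) := by
        refine (ContinuousLinearMap.opNorm_comp_le _ _).trans ?_
        gcongr
        · refine (ContinuousLinearMap.opNorm_comp_le _ _).trans ?_
          gcongr
          exact rowPairing.le_opNorm _
        · exact columnMap.le_opNorm _
    _ = _ := by ring

include hP hinv in
-- The GLM equation gives `G = P V`, whose value at `z` is the resolvent row. The correction to `q`
-- is bounded by a product of `L²` functions of `z` and `s`, hence Hilbert–Schmidt.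
lemma hasKernel_glmKernel {G : HalfL2 m →L[ℝ] HalfL2 m} (hG : P = G * (1 - P)) :
    HasKernel G (h.glmKernel P) := by
  refine ⟨?_, fun φ => ?_⟩
  · unfold glmKernel
    exact memLp_fun_add hP.1 h.memLp_resolventRow_comp_column
  · have hGV : G = P * resolventOp P := by
      have e := congrArg (· * Ring.inverse (1 - P)) hG
      simp only [mul_assoc, Ring.mul_inverse_cancel _ hinv, mul_one] at e
      exact e.symm
    have e : G φ = P (resolventOp P φ) := by rw [hGV]; rfl
    rw [e]
    filter_upwards [hP.2 (resolventOp P φ)] with z hz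
    rw [hz, ← h.rowPairing_row, ← h.resolventRow_apply hP hinv]
    rfl

end IsRegularSlice

end KP

/-! ### Translation, uniqueness of continuous kernels, density of test functions -/

namespace KP

open scoped RealInnerProductSpace

variable {m : ℕ}

lemma measurePreserving_add_Iic (c y : ℝ) : MeasurePreserving (fun s : ℝ => s + c)
    (volume.restrict (Iic y)) (volume.restrict (Iic (y + c))) := by
  have := (measurePreserving_add_right (volume : Measure ℝ) c).restrict_preimage
    (measurableSet_Iic (a := y + c))
  simpa using this

lemma setIntegral_Iic_eq_shift {E : Type*} [NormedAddCommGroup E] [NormedSpace ℝ E]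
    (F : ℝ → E) (x : ℝ) : ∫ ξ in Iic x, F ξ = ∫ s in Iic 0, F (s + x) := by
  have := (measurePreserving_add_Iic x 0).integral_comp
    (measurableEmbedding_addRight x) F
  simpa using this.symm

/-- Semi-additivity at work: raising the endpoints of the half lines amounts to increasing `x`, and
the hypothesis covers every `x`. -/
lemma memLp_shift {F : ℝ × ℝ → Mat m}
    (hF : ∀ x, MemLp (fun q : ℝ × ℝ => F (q.1 + x, q.2 + x)) 2 (halfLine.prod halfLine))
    (x y y' : ℝ) : MemLp (fun q : ℝ × ℝ => F (q.1 + x, q.2 + x)) 2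
      ((volume.restrict (Iic y)).prod (volume.restrict (Iic y'))) := by
  let M := max y y'
  have hmp := (measurePreserving_add_Iic (-M) M).prod (measurePreserving_add_Iic (-M) M)
  rw [add_neg_cancel] at hmp
  have h1 := (hF (x + M)).comp_measurePreserving hmp
  have h2 : (fun q : ℝ × ℝ => F (q.1 + (x + M), q.2 + (x + M))) ∘
      Prod.map (fun s => s + -M) (fun s => s + -M) = fun q : ℝ × ℝ => F (q.1 + x, q.2 + x) := by
    funext q
    simp only [Function.comp, Prod.map]
    congr 2 <;> ring
  rw [h2] at h1
  exact h1.mono_measure (Measure.prod_mono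
    (Measure.restrict_mono (Iic_subset_Iic.2 (le_max_left _ _)) le_rfl)
    (Measure.restrict_mono (Iic_subset_Iic.2 (le_max_right _ _)) le_rfl))

lemma IsRegularKernel.isRegularSlice {p : ℝ → ℝ → Times → Mat m} (hp : IsRegularKernel p)
    (x : ℝ) (t : Times) : IsRegularSlice fun z ζ => p (z + x) (ζ + x) t := by
  obtain ⟨hs, hd⟩ := hp t
  refine ⟨⟨?_, fun b y => ?_⟩, ⟨?_, fun a y => ?_⟩⟩
  · exact hs.comp (g := fun q : ℝ × ℝ => p q.1 q.2 t)
      (f := fun q : ℝ × ℝ => (q.1 + x, q.2 + x)) (by fun_prop)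
  · have h := memLp_shift (F := fun q : ℝ × ℝ => mixedDeriv 0 b (fun z ζ => p z ζ t) q.1 q.2)
      (hd 0 b) x 0 y
    have e : (fun q : ℝ × ℝ => colDeriv b (fun z ζ => p (z + x) (ζ + x) t) q.1 q.2) =
        fun q : ℝ × ℝ => mixedDeriv 0 b (fun z ζ => p z ζ t) (q.1 + x) (q.2 + x) := by
      funext q
      simp only [mixedDeriv, iteratedDeriv_zero]
      exact congrFun (iteratedDeriv_comp_add_const b (fun ζ => p (q.1 + x) ζ t) x) q.2
    rw [e]
    exact h
  · exact hs.comp (g := fun q : ℝ × ℝ => p q.1 q.2 t)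
      (f := fun q : ℝ × ℝ => (q.2 + x, q.1 + x)) (by fun_prop)
  · have h := memLp_shift (F := fun q : ℝ × ℝ => mixedDeriv a 0 (fun z ζ => p z ζ t) q.1 q.2)
      (hd a 0) x y 0
    have h' := h.comp_measurePreserving (Measure.measurePreserving_swap (μ := halfLine)
      (ν := volume.restrict (Iic y)))
    have e : (fun q : ℝ × ℝ => colDeriv a (fun s z => p (z + x) (s + x) t) q.1 q.2) =
        (fun q : ℝ × ℝ => mixedDeriv a 0 (fun z ζ => p z ζ t) (q.1 + x) (q.2 + x)) ∘ Prod.swap := by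
      funext q
      simp only [mixedDeriv, iteratedDeriv_zero, Function.comp, Prod.fst_swap, Prod.snd_swap]
      exact congrFun (iteratedDeriv_comp_add_const a (fun z => p z (q.1 + x) t) x) q.2
    rw [e]
    exact h'

/-- Indicators of intervals as test vectors give equal integrals over `(a, b]` for almost every `z`,
hence by continuity for every `z ≤ 0`. Differentiating in `b` recovers the kernel for `ζ < 0`;
closure adds `ζ = 0`. -/
lemma eqOn_of_kernel_eq {k k' : ℝ → ℝ → Mat m} (hk : Continuous fun q : ℝ × ℝ => k q.1 q.2)
    (hk' : Continuous fun q : ℝ × ℝ => k' q.1 q.2)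
    (h : ∀ φ : HalfL2 m, (fun z => ∫ ζ in Iic (0 : ℝ), k z ζ (φ ζ)) =ᵐ[halfLine]
      fun z => ∫ ζ in Iic (0 : ℝ), k' z ζ (φ ζ)) {z ζ : ℝ} (hz : z ≤ 0) (hζ : ζ ≤ 0) :
    k z ζ = k' z ζ := by
  ext1 v
  have hc : Continuous (fun q : ℝ × ℝ => k q.1 q.2 v) := by fun_prop
  have hc' : Continuous (fun q : ℝ × ℝ => k' q.1 q.2 v) := by fun_prop
  have hrow : ∀ z, Continuous fun ζ => k z ζ v := fun z =>
    hc.comp (by fun_prop : Continuous fun ζ : ℝ => ((z, ζ) : ℝ × ℝ))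
  have hrow' : ∀ z, Continuous fun ζ => k' z ζ v := fun z =>
    hc'.comp (by fun_prop : Continuous fun ζ : ℝ => ((z, ζ) : ℝ × ℝ))
  have hint : ∀ a b, a ≤ b → b ≤ 0 → ∀ z ≤ 0, ∫ ζ in a..b, k z ζ v = ∫ ζ in a..b, k' z ζ v := by
    intro a b hab hb
    have hfin : halfLine (Ioc a b) ≠ ⊤ :=
      ((Measure.restrict_apply_le _ _).trans_lt (by simp)).ne
    let φ : HalfL2 m := indicatorConstLp 2 measurableSet_Ioc hfin v
    have hφ : ∀ K : ℝ → Mat m, ∫ ζ in Iic (0 : ℝ), K ζ (φ ζ) = ∫ ζ in a..b, K ζ v := by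
      intro K
      have e : (fun ζ => K ζ (φ ζ)) =ᵐ[halfLine] (Ioc a b).indicator fun ζ => K ζ v := by
        filter_upwards [indicatorConstLp_coeFn (p := 2) (hs := measurableSet_Ioc) (hμs := hfin)
          (c := v)] with ζ h1
        simp only [φ, h1]
        by_cases hm : ζ ∈ Ioc a b <;> simp [hm]
      rw [integral_congr_ae e, setIntegral_indicator measurableSet_Ioc,
        intervalIntegral.integral_of_le hab, inter_eq_right.2 fun ζ hζ => hζ.2.trans hb]
    have hae := h φ
    simp only [hφ] at hae
    have hcl : Iic (0 : ℝ) ⊆ closure (interior (Iic 0)) := by rw [interior_Iic, closure_Iio]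
    exact Measure.eqOn_of_ae_eq hae
      (intervalIntegral.continuous_parametric_intervalIntegral_of_continuous' hc a b).continuousOn
      (intervalIntegral.continuous_parametric_intervalIntegral_of_continuous' hc' a b).continuousOn
      hcl
  have hlt : EqOn (fun ζ => k z ζ v) (fun ζ => k' z ζ v) (Iio 0) := by
    intro ζ (hζ : ζ < 0)
    have h1 := intervalIntegral.integral_hasDerivAt_right
      ((hrow z).intervalIntegrable (ζ - 1) ζ)
      ((hrow z).stronglyMeasurableAtFilter _ _) (hrow z).continuousAt
    have h2 := intervalIntegral.integral_hasDerivAt_right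
      ((hrow' z).intervalIntegrable (ζ - 1) ζ)
      ((hrow' z).stronglyMeasurableAtFilter _ _) (hrow' z).continuousAt
    refine h1.unique (h2.congr_of_eventuallyEq ?_)
    filter_upwards [Ioo_mem_nhds (sub_one_lt ζ) hζ] with b hb
    exact hint _ b hb.1.le hb.2.le z hz
  have := hlt.closure (hrow z) (hrow' z)
  rw [closure_Iio] at this
  exact this hζ

/-- Precomposing with `min · 0` extends both kernels continuously to the plane without changing the
operators. -/
lemma IsBracket.eq {T : HalfL2 m →L[ℝ] HalfL2 m} {k k' : ℝ → ℝ → Mat m}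
    (hk : IsBracket T k) (hk' : IsBracket T k') {z ζ : ℝ} (hz : z ≤ 0) (hζ : ζ ≤ 0) :
    k z ζ = k' z ζ := by
  have hclamp : ∀ K : ℝ → ℝ → Mat m, ContinuousOn (fun q : ℝ × ℝ => K q.1 q.2) (Iic 0 ×ˢ Iic 0) →
      Continuous fun q : ℝ × ℝ => K (min q.1 0) (min q.2 0) := fun K hK =>
    hK.comp_continuous (f := fun q : ℝ × ℝ => (min q.1 0, min q.2 0)) (by fun_prop)
      fun q => ⟨min_le_right q.1 0, min_le_right q.2 0⟩
  have hint : ∀ (K : ℝ → ℝ → Mat m) (φ : HalfL2 m), HasKernel T K →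
      (T φ : ℝ → Vec m) =ᵐ[halfLine]
        fun z => ∫ ζ in Iic (0 : ℝ), K (min z 0) (min ζ 0) (φ ζ) := fun K φ hK => by
    filter_upwards [hK.2 φ, ae_restrict_mem measurableSet_Iic] with z hz hz0
    rw [hz]
    refine setIntegral_congr_fun measurableSet_Iic fun ζ hζ => ?_
    simp only [min_eq_left (mem_Iic.1 hz0), min_eq_left (mem_Iic.1 hζ)]
  have := eqOn_of_kernel_eq (hclamp k hk.1) (hclamp k' hk'.1)
    (fun φ => (hint k φ hk.2).symm.trans (hint k' φ hk'.2)) hz hζ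
  simpa [hz, hζ] using this

/-- The adjoint represents each component of `T` by an `L²` function, which vanishes almost
everywhere on the open half line by the fundamental lemma of the calculus of variations. -/
lemma eq_zero_of_test {T : HalfL2 m →L[ℝ] Vec m}
    (hT : ∀ ψ : ℝ → Vec m, IsTest ψ → tsupport ψ ⊆ Iio 0 →
      ∀ φ : HalfL2 m, φ =ᵐ[halfLine] ψ → T φ = 0) : T = 0 := by
  ext1 φ
  refine ext_inner_left ℝ fun w => ?_
  rw [← ContinuousLinearMap.adjoint_inner_left]
  suffices h0 : T.adjoint w = 0 by simp [h0]
  set χ := T.adjoint w with hχ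
  have hLp : MemLp χ 2 halfLine := Lp.memLp χ
  have hloc : LocallyIntegrable χ halfLine := hLp.locallyIntegrable one_le_two
  have hae := isOpen_Iio.ae_eq_zero_of_integral_contDiff_smul_eq_zero (U := Iio (0 : ℝ))
    (hloc.locallyIntegrableOn _) (fun g hg hgc hgs => by
      refine ext_inner_left ℝ fun v => ?_
      have hψ : IsTest fun s => g s • v := ⟨hg.smul contDiff_const, hgc.smul_right⟩
      have hψL : MemLp (fun s => g s • v) 2 halfLine :=
        hψ.1.continuous.memLp_of_hasCompactSupport hψ.2
      have hgint : Integrable (fun s => g s • χ s) halfLine :=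
        hloc.integrable_smul_left_of_hasCompactSupport hg.continuous hgc
      have h0 := hT _ hψ ((closure_mono (Function.support_smul_subset_left g fun _ => v)).trans hgs)
        hψL.toLp hψL.coeFn_toLp
      rw [← integral_inner hgint, inner_zero_right]
      calc _ = ⟪hψL.toLp, χ⟫ := by
            rw [L2.inner_def]
            refine integral_congr_ae ?_
            filter_upwards [hψL.coeFn_toLp] with s hs
            rw [hs, real_inner_smul_left, real_inner_smul_right]
        _ = 0 := by
            rw [real_inner_comm, hχ, ContinuousLinearMap.adjoint_inner_left, h0, inner_zero_right])
  rw [Lp.eq_zero_iff_ae_eq_zero]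
  have hne : ∀ᵐ s ∂halfLine, s ≠ 0 := Measure.ae_ne _ 0
  filter_upwards [hae, ae_restrict_mem measurableSet_Iic, hne] with s h1 h2 h3
  exact h1 (lt_of_le_of_ne h2 h3)

end KP

/-! ### Expansion in powers of `∂⁻¹` and uniqueness of its coefficients -/

namespace KP

variable {m : ℕ}

lemma setIntegral_Iic_eq_intervalIntegral {E : Type*} [NormedAddCommGroup E] [NormedSpace ℝ E]
    {f : ℝ → E} {A : ℝ} (hf : Continuous f) (hA : ∀ s ≤ A, f s = 0) (x : ℝ) :
    ∫ s in Iic x, f s = ∫ s in A..x, f s := by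
  have h0 : IntegrableOn f (Iic A) :=
    integrableOn_zero.congr_fun (fun s hs => (hA s hs).symm) measurableSet_Iic
  have hx : IntegrableOn f (Iic x) :=
    (h0.union hf.integrableOn_Icc (s := Iic A) (t := Icc A x)).mono_set fun s hs =>
      (le_total s A).imp id fun h => ⟨h, hs⟩
  rw [← intervalIntegral.integral_Iic_sub_Iic h0 hx,
    setIntegral_congr_fun measurableSet_Iic (g := fun _ => (0 : E)) fun s hs => hA s hs]
  simp

/-- Continuous functions vanishing near `-∞`. -/
structure IsLeftSupported (A : ℝ) (Ψ : ℝ → Vec m) : Prop where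
  continuous : Continuous Ψ
  eq_zero : ∀ s ≤ A, Ψ s = 0

lemma IsLeftSupported.invDeriv_eq {A : ℝ} {Ψ : ℝ → Vec m} (h : IsLeftSupported A Ψ) :
    invDeriv Ψ = fun x => ∫ s in A..x, Ψ s :=
  funext fun x => setIntegral_Iic_eq_intervalIntegral h.continuous h.eq_zero x

lemma IsLeftSupported.hasDerivAt_invDeriv {A : ℝ} {Ψ : ℝ → Vec m} (h : IsLeftSupported A Ψ)
    (x : ℝ) : HasDerivAt (invDeriv Ψ) (Ψ x) x := by
  rw [h.invDeriv_eq]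
  exact intervalIntegral.integral_hasDerivAt_right (h.continuous.intervalIntegrable _ _)
    (h.continuous.stronglyMeasurableAtFilter _ _) h.continuous.continuousAt

lemma IsLeftSupported.invDeriv {A : ℝ} {Ψ : ℝ → Vec m} (h : IsLeftSupported A Ψ) :
    IsLeftSupported A (invDeriv Ψ) where
  continuous := continuous_iff_continuousAt.2 fun x => (h.hasDerivAt_invDeriv x).continuousAt
  eq_zero x hx := by
    rw [KP.invDeriv, setIntegral_congr_fun measurableSet_Iic (g := fun _ => (0 : Vec m))
      fun s hs => h.eq_zero s (le_trans hs hx)]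
    simp

lemma IsTest.exists_isLeftSupported {ψ : ℝ → Vec m} (h : IsTest ψ) :
    ∃ A, IsLeftSupported A ψ := by
  obtain ⟨A, hA⟩ := h.2.isCompact.bddBelow
  refine ⟨A - 1, h.1.continuous, fun s hs => ?_⟩
  by_contra hne
  have := hA (subset_tsupport ψ hne)
  linarith

lemma IsLeftSupported.integral_by_parts {A : ℝ} {Ψ : ℝ → Vec m} (h : IsLeftSupported A Ψ)
    {K K' : ℝ → Mat m} (hK : ∀ s, HasDerivAt K (K' s) s) (hK' : Continuous K') (x : ℝ) :
    ∫ s in Iic x, K s (Ψ s) = K x (KP.invDeriv Ψ x) - ∫ s in Iic x, K' s (KP.invDeriv Ψ s) := by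
  have hKc : Continuous K := continuous_iff_continuousAt.2 fun s => (hK s).continuousAt
  have c1 : Continuous fun s => K s (Ψ s) := hKc.clm_apply h.continuous
  have c2 : Continuous fun s => K' s (KP.invDeriv Ψ s) := hK'.clm_apply h.invDeriv.continuous
  rw [setIntegral_Iic_eq_intervalIntegral c1 (A := A) (fun s hs => by simp [h.eq_zero s hs]),
    setIntegral_Iic_eq_intervalIntegral c2 (A := A) (fun s hs => by simp [h.invDeriv.eq_zero s hs]),
    eq_sub_iff_add_eq, ← intervalIntegral.integral_add (c1.intervalIntegrable _ _)
      (c2.intervalIntegrable _ _)]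
  have := intervalIntegral.integral_eq_sub_of_hasDerivAt (a := A) (b := x)
    (fun s _ => (hK s).clm_apply (h.hasDerivAt_invDeriv s)) ((c2.add c1).intervalIntegrable _ _)
  simp only [h.invDeriv.eq_zero A le_rfl, map_zero, sub_zero] at this
  rw [← this]
  exact intervalIntegral.integral_congr fun s _ => add_comm _ _

lemma IsLeftSupported.iterate_invDeriv {A : ℝ} {Ψ : ℝ → Vec m} (h : IsLeftSupported A Ψ)
    (N : ℕ) : IsLeftSupported A (KP.invDeriv^[N] Ψ) := by
  induction N with
  | zero => exact h
  | succ N ih => rw [Function.iterate_succ_apply']; exact ih.invDeriv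

/-- Each integration by parts moves one derivative onto `K` and leaves a boundary term at `x` only,
since all iterated primitives vanish near `-∞`. -/
lemma IsLeftSupported.integral_expansion {A : ℝ} {Ψ : ℝ → Vec m} (h : IsLeftSupported A Ψ)
    {K : ℝ → Mat m} (hK : ContDiff ℝ ∞ K) (x : ℝ) (N : ℕ) :
    ∫ s in Iic x, K s (Ψ s) =
      -∑ k ∈ Finset.Icc 1 N, ((-1 : ℝ) ^ k • iteratedDeriv (k - 1) K x) (KP.invDeriv^[k] Ψ x) +
      ∫ s in Iic x, ((-1 : ℝ) ^ N • iteratedDeriv N K s) (KP.invDeriv^[N] Ψ s) := by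
  induction N with
  | zero => simp
  | succ N ih =>
    have hd : ∀ s, HasDerivAt (fun s => (-1 : ℝ) ^ N • iteratedDeriv N K s)
        ((-1 : ℝ) ^ N • iteratedDeriv (N + 1) K s) s := fun s => by
      rw [iteratedDeriv_succ]
      exact ((hK.differentiable_iteratedDeriv N
        (by exact_mod_cast WithTop.coe_lt_top _) s).hasDerivAt).fun_const_smul ((-1 : ℝ) ^ N)
    have hc : Continuous fun s => (-1 : ℝ) ^ N • iteratedDeriv (N + 1) K s :=
      (hK.continuous_iteratedDeriv (N + 1) (by exact_mod_cast le_top)).const_smul ((-1 : ℝ) ^ N)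
    rw [ih, (h.iterate_invDeriv N).integral_by_parts hd hc, Finset.sum_Icc_succ_top (by omega)]
    have hneg : ∀ (M : Mat m) (v : Vec m),
        ((-1 : ℝ) ^ (N + 1) • M) v = -(((-1 : ℝ) ^ N • M) v) := fun M v => by
      rw [pow_succ, mul_neg_one]
      simp
    simp only [Function.iterate_succ_apply', Nat.add_sub_cancel, hneg, integral_neg]
    abel

lemma invDeriv_deriv {Ψ : ℝ → Vec m} (h : IsTest Ψ) : invDeriv (deriv Ψ) = Ψ :=
  funext fun x => h.2.integral_Iic_deriv_eq (h.1.of_le (by exact_mod_cast le_top)) x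

lemma IsTest.iteratedDeriv {Ψ : ℝ → Vec m} (h : IsTest Ψ) (k : ℕ) : IsTest (iteratedDeriv k Ψ) := by
  induction k with
  | zero => simpa using h
  | succ k ih =>
    rw [iteratedDeriv_succ]
    exact ⟨(contDiff_infty_iff_deriv.1 ih.1).2, ih.2.deriv⟩

lemma iterate_invDeriv_iteratedDeriv {Ψ : ℝ → Vec m} (h : IsTest Ψ) (j i : ℕ) :
    invDeriv^[j] (iteratedDeriv (i + j) Ψ) = iteratedDeriv i Ψ := by
  induction j with
  | zero => rfl
  | succ j ih =>
    rw [Function.iterate_succ_apply, ← add_assoc, iteratedDeriv_succ,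
      invDeriv_deriv (h.iteratedDeriv _), ih]

/-- A smooth bump function of width `ε` at `x`, with values along `v`. -/
lemma exists_test_bump (x : ℝ) (v : Vec m) {ε : ℝ} (hε : 0 < ε) :
    ∃ Ψ : ℝ → Vec m, IsTest Ψ ∧ Ψ x = v ∧ (∀ j, 1 ≤ j → iteratedDeriv j Ψ x = 0) ∧
      (∀ s, ‖Ψ s‖ ≤ ‖v‖) ∧ ∀ s ≤ x - ε, Ψ s = 0 := by
  let f : ContDiffBump x := ⟨ε / 2, ε, by positivity, by linarith⟩
  refine ⟨fun s => f s • v, ⟨f.contDiff.smul contDiff_const, f.hasCompactSupport.smul_right⟩,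
    ?_, fun j hj => ?_, fun s => ?_, fun s hs => ?_⟩
  · have : f x = 1 := f.eventuallyEq_one.eq_of_nhds
    simp [this]
  · have e : (fun s => f s • v) =ᶠ[nhds x] fun _ => v := by
      filter_upwards [f.eventuallyEq_one] with s hs
      simp [hs]
    rw [e.iteratedDeriv_eq, iteratedDeriv_const]
    simp [show j ≠ 0 by omega]
  · rw [norm_smul, Real.norm_of_nonneg f.nonneg]
    exact mul_le_of_le_one_left (norm_nonneg _) f.le_one
  · have : f s = 0 := f.zero_of_le_dist (by
      rw [Real.dist_eq, abs_sub_comm]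
      exact le_trans (by simp only [f]; linarith) (le_abs_self _))
    simp [this]

lemma norm_lowerVolterra_bump_le {r : ℝ → ℝ → Mat m} {x C ε : ℝ} {v : Vec m} {Ψ : ℝ → Vec m}
    (hC : ∀ s ∈ Icc (x - 1) x, ‖r x s‖ ≤ C) (hε : 0 < ε) (hε1 : ε ≤ 1)
    (hb : ∀ s, ‖Ψ s‖ ≤ ‖v‖) (h0 : ∀ s ≤ x - ε, Ψ s = 0) :
    ‖lowerVolterra r Ψ x‖ ≤ C * ‖v‖ * ε := by
  have e : lowerVolterra r Ψ x = ∫ s in Icc (x - ε) x, r x s (Ψ s) :=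
    setIntegral_eq_of_subset_of_forall_sdiff_eq_zero measurableSet_Iic Icc_subset_Iic_self
      fun s hs => by
        have : s ≤ x - ε := by
          by_contra hlt
          exact hs.2 ⟨(not_le.1 hlt).le, hs.1⟩
        simp [h0 s this]
  rw [e]
  have := norm_setIntegral_le_of_norm_le_const (μ := volume) (s := Icc (x - ε) x)
    (f := fun s => r x s (Ψ s)) (C := C * ‖v‖) (by simp) fun s hs => by
      have hs' : s ∈ Icc (x - 1) x := ⟨by linarith [hs.1], hs.2⟩
      exact ((r x s).le_opNorm _).trans (mul_le_mul (hC s hs') (hb s) (norm_nonneg _)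
        ((norm_nonneg _).trans (hC s hs')))
  simpa [measureReal_def, hε.le] using this

/-- Test on the `k`-th derivative of a bump `Ψ` that is constant equal to `v` near `x`. Then
`∂^{-j}` of it at `x` is a positive-order derivative of `Ψ`, hence zero, for `j < k`, and is `v` for
`j = k`. The remainder is an integral of `Ψ` over a window of length `ε`. -/
lemma HasGaugeExpansion.coeff_unique {W : (ℝ → Vec m) → ℝ → Vec m} {w w' : ℕ → ℝ → Mat m}
    (hw : HasGaugeExpansion W w) (hw' : HasGaugeExpansion W w') {k : ℕ} (hk : 1 ≤ k) (x : ℝ) :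
    w k x = w' k x := by
  ext1 v
  obtain ⟨r, hr, H⟩ := hw k
  obtain ⟨r', hr', H'⟩ := hw' k
  obtain ⟨C, hC⟩ := (isCompact_Icc (a := x - 1) (b := x)).exists_bound_of_continuousOn
    ((hr x).mono Icc_subset_Iic_self)
  obtain ⟨C', hC'⟩ := (isCompact_Icc (a := x - 1) (b := x)).exists_bound_of_continuousOn
    ((hr' x).mono Icc_subset_Iic_self)
  have hbound : ∀ ε : ℝ, 0 < ε → ε ≤ 1 →
      ‖w k x v - w' k x v‖ ≤ (C * ‖v‖ + C' * ‖v‖) * ε := by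
    intro ε hε hε1
    obtain ⟨Ψ, hΨ, hΨx, hΨd, hΨb, hΨ0⟩ := exists_test_bump x v hε
    have hterm : ∀ u : ℕ → ℝ → Mat m,
        ∑ j ∈ Finset.Icc 1 k, u j x (invDeriv^[j] (iteratedDeriv k Ψ) x) = u k x v := by
      intro u
      rw [Finset.sum_eq_single_of_mem k (by simp [hk])]
      · have := iterate_invDeriv_iteratedDeriv hΨ k 0
        rw [zero_add, iteratedDeriv_zero] at this
        rw [this, hΨx]
      · intro j hj hjk
        obtain ⟨h1, h2⟩ := Finset.mem_Icc.1 hj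
        have := iterate_invDeriv_iteratedDeriv hΨ j (k - j)
        rw [Nat.sub_add_cancel h2] at this
        rw [this, hΨd _ (by omega), map_zero]
    have hk0 : invDeriv^[k] (iteratedDeriv k Ψ) = Ψ := by
      have := iterate_invDeriv_iteratedDeriv hΨ k 0
      rwa [zero_add, iteratedDeriv_zero] at this
    have e := H _ (hΨ.iteratedDeriv k) x
    have e' := H' _ (hΨ.iteratedDeriv k) x
    rw [hterm, hk0] at e e'
    have hd : w k x v - w' k x v = lowerVolterra r Ψ x - lowerVolterra r' Ψ x := by
      rw [e] at e'
      rw [sub_eq_sub_iff_add_eq_add, ← sub_eq_zero]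
      rw [← sub_eq_zero] at e'
      rw [← neg_eq_zero, ← e']
      abel
    rw [hd, add_mul]
    exact (norm_sub_le _ _).trans (add_le_add
      (norm_lowerVolterra_bump_le hC hε hε1 hΨb hΨ0)
      (norm_lowerVolterra_bump_le hC' hε hε1 hΨb hΨ0))
  -- `C` and `C'` bound the remainders on the fixed window `[x - 1, x]`, independently of `ε`, so
  -- `ε` may tend to zero.
  have hlim : Filter.Tendsto (fun ε : ℝ => (C * ‖v‖ + C' * ‖v‖) * ε) (nhdsWithin 0 (Ioi 0))
      (nhds 0) := by
    have : Continuous fun ε : ℝ => (C * ‖v‖ + C' * ‖v‖) * ε := by fun_prop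
    simpa using (this.tendsto 0).mono_left nhdsWithin_le_nhds
  have := ge_of_tendsto hlim (by
    filter_upwards [Ioc_mem_nhdsGT (zero_lt_one' ℝ)] with ε hε using hbound ε hε.1 hε.2)
  exact sub_eq_zero.1 (norm_le_zero_iff.1 this)

/-- The coefficients of a Volterra operator `id + K` with smooth kernel rows `K x`. -/
lemma hasGaugeExpansion_iff {W : (ℝ → Vec m) → ℝ → Vec m} {K : ℝ → ℝ → Mat m}
    (hK : ∀ x, ContDiff ℝ ∞ (K x))
    (hW : ∀ ψ, IsTest ψ → ∀ x, W ψ x = ψ x + ∫ ξ in Iic x, K x ξ (ψ ξ)) (w : ℕ → ℝ → Mat m) :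
    HasGaugeExpansion W w ↔
      ∀ k, 1 ≤ k → ∀ x, w k x = (-1 : ℝ) ^ k • iteratedDeriv (k - 1) (K x) x := by
  have key : ∀ w : ℕ → ℝ → Mat m,
      (∀ k, 1 ≤ k → ∀ x, w k x = (-1 : ℝ) ^ k • iteratedDeriv (k - 1) (K x) x) →
        HasGaugeExpansion W w := by
    intro w hw N
    refine ⟨fun x s => (-1 : ℝ) ^ N • iteratedDeriv N (K x) s, fun x => ?_, fun ψ hψ x => ?_⟩
    · exact (((hK x).continuous_iteratedDeriv N (by exact_mod_cast le_top)).const_smul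
        ((-1 : ℝ) ^ N)).continuousOn
    · obtain ⟨A, hA⟩ := hψ.exists_isLeftSupported
      rw [hW ψ hψ, hA.integral_expansion (hK x) x N,
        Finset.sum_congr rfl fun k hk => by rw [← hw k (Finset.mem_Icc.1 hk).1 x]]
      simp only [lowerVolterra]
      abel
  exact ⟨fun h k hk x => h.coeff_unique
    (key (fun k x => (-1 : ℝ) ^ k • iteratedDeriv (k - 1) (K x) x) fun _ _ _ => rfl) hk x, key w⟩

end KP

/-! ### The scattering equation and the resolvent row -/

namespace KP

variable {m : ℕ}

lemma lowerVolterra_eq_shift (k : ℝ → ℝ → Mat m) (ψ : ℝ → Vec m) (x : ℝ) :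
    lowerVolterra k ψ x = ∫ s in Iic 0, k x (s + x) (ψ (s + x)) :=
  setIntegral_Iic_eq_shift _ x

/-- The rows `k(x, · + x)` of a Volterra kernel, as functionals on `𝕍`. -/
lemma lowerVolterra_eq_rowPairing {k : ℝ → ℝ → Mat m} {x : ℝ}
    (hk : MemLp (fun s => k x (s + x)) 2 halfLine) {ψ : ℝ → Vec m} {φ : HalfL2 m}
    (hφ : φ =ᵐ[halfLine] fun s => ψ (s + x)) :
    lowerVolterra k ψ x = rowPairing hk.toLp φ := by
  rw [lowerVolterra_eq_shift, rowPairing_eq_integral hk.coeFn_toLp]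
  refine integral_congr_ae ?_
  filter_upwards [hφ] with s hs
  rw [hs]

lemma memLp_row_shift {k : ℝ → Mat m} {x : ℝ} (hk : MemLp k 2 (volume.restrict (Iic x))) :
    MemLp (fun s => k (s + x)) 2 halfLine := by
  have h := measurePreserving_add_Iic x 0
  rw [zero_add] at h
  exact hk.comp_measurePreserving h

lemma IsTest.comp_add_const {ψ : ℝ → Vec m} (h : IsTest ψ) (x : ℝ) :
    IsTest fun s => ψ (s + x) :=
  ⟨h.1.comp (by fun_prop), h.2.comp_homeomorph (Homeomorph.addRight x)⟩

lemma IsTest.memLp {ψ : ℝ → Vec m} (h : IsTest ψ) (μ : Measure ℝ)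
    [IsFiniteMeasureOnCompacts μ] : MemLp ψ 2 μ :=
  h.1.continuous.memLp_of_hasCompactSupport h.2

namespace IsRegularSlice

variable {q : ℝ → ℝ → Mat m} (h : IsRegularSlice q)

include h in
lemma exists_kernel_integral {ψ : ℝ → Vec m} (hψ : IsTest ψ) :
    ∃ Φ : HalfL2 m, (Φ =ᵐ[halfLine] fun η => ∫ s, q η s (ψ s)) ∧
      ∀ L : HalfL2 m →L[ℝ] Vec m,
        L Φ = ∫ s, (L ∘L columnMap (h.cols.column 0 s)) (ψ s) := by
  -- The support of `ψ` may extend past `0`, so columns with `s` up to `y` are needed, not only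
  -- those in the half line.
  obtain ⟨y, hy⟩ := hψ.2.isCompact.bddAbove
  have h0 : ∀ s ∉ Iic y, ψ s = 0 := fun s hs => by
    by_contra hne
    exact hs (hy (subset_tsupport ψ hne))
  have hI : ∀ k : ℝ → Mat m, ∫ s in Iic y, k s (ψ s) = ∫ s, k s (ψ s) := fun k =>
    setIntegral_eq_integral_of_forall_compl_eq_zero fun s hs => by simp [h0 s hs]
  have hL := hψ.memLp (volume.restrict (Iic y))
  have hM := memLp_kernel_integral (h.cols.memLp_prod 0 y) hL
  have hΦ : hM.toLp =ᵐ[halfLine] fun η => ∫ s in Iic y, q η s (ψ s) := hM.coeFn_toLp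
  refine ⟨hM.toLp, ?_, fun L => ?_⟩
  · simpa only [hI] using hΦ
  · rw [functional_kernel_integral h.cols hL hΦ L, hI fun s => L ∘L columnMap (h.cols.column 0 s)]

variable {P : HalfL2 m →L[ℝ] HalfL2 m} (hP : HasKernel P q) (hinv : IsUnit (1 - P))

include hP hinv in
/-- `id - P'` composed with the kernel row at `z = 0` over the whole line. -/
lemma setIntegral_glmKernel_sub {ψ : ℝ → Vec m} (hψ : IsTest ψ) :
    ∫ s in Iic (0 : ℝ), h.glmKernel P 0 s (ψ s - ∫ s', q s s' (ψ s')) =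
      (∫ s, q 0 s (ψ s)) - ∫ s in Ici (0 : ℝ), h.glmKernel P 0 s (ψ s) := by
  obtain ⟨Φ, hΦ, hL⟩ := h.exists_kernel_integral hψ
  have hφ := hψ.memLp halfLine
  have hq : Continuous fun s => q 0 s := (HasL2Columns.contDiff_row h.cols.contDiff 0).continuous
  have hg : Continuous fun s => h.glmKernel P 0 s := (h.contDiff_glmKernel P 0).continuous
  have hint : ∀ k : ℝ → Mat m, Continuous k → Integrable fun s => k s (ψ s) := fun k hk =>
    (hk.clm_apply hψ.1.continuous).integrable_of_hasCompactSupport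
      (hψ.2.mono fun s hs hs0 => hs (by simp [hs0]))
  have e1 : ∫ s in Iic (0 : ℝ), h.glmKernel P 0 s (ψ s - ∫ s', q s s' (ψ s')) =
      h.resolventRow P 0 (hφ.toLp - Φ) := by
    rw [h.resolventRow_apply hP hinv]
    refine integral_congr_ae ?_
    filter_upwards [hΦ, hφ.coeFn_toLp, Lp.coeFn_sub hφ.toLp Φ] with s h1 h2 h3
    rw [h3, Pi.sub_apply, h2, h1]
  have e2 : h.resolventRow P 0 hφ.toLp = ∫ s in Iic (0 : ℝ), h.glmKernel P 0 s (ψ s) := by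
    rw [h.resolventRow_apply hP hinv]
    refine integral_congr_ae ?_
    filter_upwards [hφ.coeFn_toLp] with s h2
    rw [h2]
  -- Here the definition of `glmKernel` is used on the whole line: its part over `s > 0` is what
  -- becomes `K₊`.
  have e3 : (∫ s, q 0 s (ψ s)) + h.resolventRow P 0 Φ = ∫ s, h.glmKernel P 0 s (ψ s) := by
    rw [hL, ← integral_add (hint _ hq) (hint _ (continuous_comp_column h.cols _))]
    rfl
  have e4 : ∫ s, h.glmKernel P 0 s (ψ s) = (∫ s in Iic (0 : ℝ), h.glmKernel P 0 s (ψ s)) +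
      ∫ s in Ici (0 : ℝ), h.glmKernel P 0 s (ψ s) := by
    rw [integral_Ici_eq_integral_Ioi, intervalIntegral.integral_Iic_add_Ioi
      (hint _ hg).integrableOn (hint _ hg).integrableOn]
  rw [e1, map_sub, e2, sub_eq_sub_iff_add_eq_add]
  rw [e4] at e3
  rw [← sub_eq_zero] at e3 ⊢
  rw [← neg_eq_zero, ← e3]
  abel

include hinv in
/-- A row `K` satisfying the scattering equation to the left of the diagonal is the row of
`(id - P)⁻¹` composed with the row of `P`. -/
lemma eq_resolventRow {K : HalfL2 m →L[ℝ] Vec m}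
    (hK : ∀ ψ : ℝ → Vec m, IsTest ψ → tsupport ψ ⊆ Iio 0 → ∀ φ : HalfL2 m, φ =ᵐ[halfLine] ψ →
      K (φ - P φ) = ∫ s in Iic (0 : ℝ), q 0 s (φ s)) :
    K = h.resolventRow P 0 := by
  -- By density the hypothesis is an identity of functionals, and `1 - P` can be cancelled on the
  -- right.
  have h1 : K ∘L (1 - P) - rowPairing (h.rows.column 0 0) = 0 :=
    eq_zero_of_test fun ψ hψ hs φ hφ => by
      have := hK ψ hψ hs φ hφ
      rw [← h.rowPairing_row] at this
      simp only [sub_apply, ContinuousLinearMap.comp_apply, one_apply_eq_self]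
      rw [this, sub_self]
  rw [sub_eq_zero] at h1
  rw [resolventRow, ← h1, resolventOp]
  ext1 φ
  have := congrArg (fun T : HalfL2 m →L[ℝ] HalfL2 m => T φ) (Ring.mul_inverse_cancel _ hinv)
  simp only [mul_apply_eq_comp, one_apply_eq_self] at this
  simp only [ContinuousLinearMap.comp_apply]
  rw [this]

end IsRegularSlice

section Scattering

variable {p' : ℝ → ℝ → Mat m} {x : ℝ} (h : IsRegularSlice fun z ζ => p' (z + x) (ζ + x))
  {P : HalfL2 m →L[ℝ] HalfL2 m} (hP : HasKernel P fun z ζ => p' (z + x) (ζ + x))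
  (hinv : IsUnit (1 - P))

lemma idSubFull_shift (p' : ℝ → ℝ → Mat m) (ψ : ℝ → Vec m) (x s : ℝ) :
    idSubFull p' ψ (s + x) = ψ (s + x) - ∫ s', p' (s + x) (s' + x) (ψ (s' + x)) := by
  rw [idSubFull, ← integral_add_right_eq_self _ x]

include hP hinv in
lemma factorization_glmKernel {kminus kplus : ℝ → ℝ → Mat m}
    (hm : ∀ s, kminus x s = h.glmKernel P 0 (s - x))
    (hp : ∀ s, kplus x s = -h.glmKernel P 0 (s - x)) {ψ : ℝ → Vec m} (hψ : IsTest ψ) :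
    idAddLower kminus (idSubFull p' ψ) x = idAddUpper kplus ψ x := by
  have hU : upperVolterra kplus ψ x =
      -∫ s in Ici (0 : ℝ), h.glmKernel P 0 s (ψ (s + x)) := by
    have := ((measurePreserving_add_right (volume : Measure ℝ) x).setIntegral_preimage_emb
      (measurableEmbedding_addRight x) (fun ξ => kplus x ξ (ψ ξ)) (Ici x))
    rw [upperVolterra, ← this, ← integral_neg]
    simp [hp]
  have h0 := idSubFull_shift p' ψ x 0
  have key := h.setIntegral_glmKernel_sub hP hinv (hψ.comp_add_const x)
  simp only [zero_add] at h0 key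
  rw [idAddLower, idAddUpper, hU, lowerVolterra_eq_shift, h0]
  simp only [hm, add_sub_cancel_right, idSubFull_shift]
  rw [key]
  abel

include hP hinv in
-- For a test function supported strictly to the left of `x` the `K₊` integral vanishes and `P'`
-- acts as `P` on the half line, leaving an equation for the row of `K₋` alone.
lemma rowPairing_eq_resolventRow {kminus kplus : ℝ → ℝ → Mat m}
    (hk : MemLp (fun s => kminus x (s + x)) 2 halfLine)
    (hF : ∀ ψ : ℝ → Vec m, IsTest ψ →
      idAddLower kminus (idSubFull p' ψ) x = idAddUpper kplus ψ x) :
    rowPairing hk.toLp = h.resolventRow P 0 := by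
  refine h.eq_resolventRow hinv fun ψ hψ hs φ hφ => ?_
  have hψ0 : ∀ s, 0 ≤ s → ψ s = 0 := fun s hs0 => by
    by_contra hne
    exact not_lt.2 hs0 (hs (subset_tsupport ψ hne))
  have hI : ∀ k : ℝ → Mat m, ∫ s, k s (ψ s) = ∫ s in Iic (0 : ℝ), k s (φ s) := fun k => by
    rw [← setIntegral_eq_integral_of_forall_compl_eq_zero (s := Iic (0 : ℝ))
      fun s hs => by simp [hψ0 s (not_le.1 hs).le]]
    refine integral_congr_ae ?_
    filter_upwards [hφ] with s hs
    rw [hs]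
  let ψ' : ℝ → Vec m := fun ξ => ψ (ξ - x)
  have hψ' : IsTest ψ' := by simpa [ψ', sub_eq_add_neg] using hψ.comp_add_const (-x)
  have hφ' : (φ - P φ : HalfL2 m) =ᵐ[halfLine] fun s => idSubFull p' ψ' (s + x) := by
    filter_upwards [Lp.coeFn_sub φ (P φ), hφ, hP.2 φ] with s h1 h2 h3
    rw [h1, Pi.sub_apply, h2, h3, idSubFull_shift]
    simp only [ψ', add_sub_cancel_right]
    rw [hI fun s' => p' (s + x) (s' + x)]
  have hU : upperVolterra kplus ψ' x = 0 := by
    rw [upperVolterra, setIntegral_congr_fun measurableSet_Ici (g := fun _ => (0 : Vec m))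
      fun ξ hξ => by simp [ψ', hψ0 (ξ - x) (sub_nonneg.2 hξ)]]
    simp
  have e := hF ψ' hψ'
  have h0 := idSubFull_shift p' ψ' x 0
  simp only [ψ', add_sub_cancel_right] at h0
  rw [hI fun s' => p' (0 + x) (s' + x)] at h0
  rw [idAddLower, idAddUpper, lowerVolterra_eq_rowPairing hk hφ', hU, add_zero] at e
  simp only [zero_add] at h0 ⊢
  rw [h0, sub_add_eq_add_sub, sub_eq_iff_eq_add] at e
  have hx : ψ' x = ψ 0 := by simp [ψ']
  rw [hx] at e
  exact add_left_cancel e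

include hP hinv in
/-- The gauge operator in terms of the row of `P (id - P)⁻¹`. -/
lemma IsScatteringFactorization.gaugeOperator_eq {kminus kplus : ℝ → ℝ → Mat m}
    (hF : IsScatteringFactorization p' kminus kplus) {ψ : ℝ → Vec m} {φ : HalfL2 m}
    (hφ : φ =ᵐ[halfLine] fun s => ψ (s + x)) :
    gaugeOperator kminus ψ x = ψ x + h.resolventRow P 0 φ := by
  have hk : MemLp (fun s => kminus x (s + x)) 2 halfLine := memLp_row_shift (hF.1 x)
  rw [gaugeOperator, idAddLower, lowerVolterra_eq_rowPairing hk hφ,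
    rowPairing_eq_resolventRow h hP hinv hk fun ψ hψ => hF.2.2 ψ hψ x]

end Scattering

/-- `(id - P)⁻¹ φ = φ + P (id - P)⁻¹ φ` has a continuous representative. -/
lemma IsRegularSlice.resolventOp_ae_eq {q : ℝ → ℝ → Mat m} (h : IsRegularSlice q)
    {P : HalfL2 m →L[ℝ] HalfL2 m} (hP : HasKernel P q) (hinv : IsUnit (1 - P)) {f : ℝ → Vec m}
    {φ : HalfL2 m} (hφ : φ =ᵐ[halfLine] f) :
    resolventOp P φ =ᵐ[halfLine] fun z => f z + h.resolventRow P z φ := by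
  have hV : resolventOp P φ = φ + P (resolventOp P φ) := by
    have := congrArg (fun T : HalfL2 m →L[ℝ] HalfL2 m => T φ) (Ring.mul_inverse_cancel _ hinv)
    simp only [mul_apply_eq_comp, sub_apply, one_apply_eq_self] at this
    exact sub_eq_iff_eq_add.1 this
  filter_upwards [Lp.coeFn_add φ (P (resolventOp P φ)), hφ, hP.2 (resolventOp P φ)] with z h1 h2 h3
  rw [hV, h1, Pi.add_apply, h2, h3, ← h.rowPairing_row]
  rfl

lemma IsRegularSlice.continuous_resolventRow_apply {q : ℝ → ℝ → Mat m} (h : IsRegularSlice q)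
    (P : HalfL2 m →L[ℝ] HalfL2 m) (φ : HalfL2 m) : Continuous fun z => h.resolventRow P z φ := by
  have h1 := (h.rows.contDiff_column 0).continuous
  unfold resolventRow
  fun_prop

end KP

end

/-! ### The main theorem -/

theorem theorem4p2 (m : ℕ)
    (p : ℝ → ℝ → KP.Times → KP.Mat m)
    (P G : ℝ → KP.Times → KP.HalfL2 m →L[ℝ] KP.HalfL2 m)
    (hp : KP.IsRegularKernel p)
    (hP : KP.IsSemiAdditive P p)
    (hinv : ∀ x t, IsUnit (1 - P x t))
    (hG : ∀ x t, P x t = G x t * (1 - P x t)) :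
    -- the kernel `⟦G⟧(z, ζ; x, t)` and the gauge operator exist
    (∃ g : ℝ → ℝ → ℝ → KP.Times → KP.Mat m,
      ∀ x t, KP.IsBracket (G x t) (fun z ζ => g z ζ x t)) ∧
    (∃ kminus kplus : ℝ → ℝ → KP.Times → KP.Mat m,
      ∀ t, KP.IsScatteringFactorization (fun x ξ => p x ξ t)
        (fun x ξ => kminus x ξ t) (fun x ξ => kplus x ξ t)) ∧
    ∀ g : ℝ → ℝ → ℝ → KP.Times → KP.Mat m,
      (∀ x t, KP.IsBracket (G x t) (fun z ζ => g z ζ x t)) →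
    ∀ kminus kplus : ℝ → ℝ → KP.Times → KP.Mat m,
      (∀ t, KP.IsScatteringFactorization (fun x ξ => p x ξ t)
        (fun x ξ => kminus x ξ t) (fun x ξ => kplus x ξ t)) →
      -- the right derivatives of the kernel exist to all orders
      (∀ x t, ∀ z ≤ 0, ContDiffOn ℝ ∞ (fun ζ => g z ζ x t) (Iic 0)) ∧
      -- the coefficients of `W` exist, are unique, and are the signed right derivatives
      (∀ w : ℕ → ℝ → KP.Times → KP.Mat m,
        (∀ t, KP.HasGaugeExpansion (KP.gaugeOperator fun x ξ => kminus x ξ t)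
          (fun k x => w k x t)) ↔
        ∀ k, 1 ≤ k → ∀ x t,
          w k x t = (-1 : ℝ) ^ k • KP.rightDeriv (k - 1) (fun z ζ => g z ζ x t) 0 0) ∧
      -- `W = V`: `(W ψ)(x)` is the value at `z = 0` of `V(x, t)` applied to `ζ ↦ ψ(ζ + x)`
      (∀ (t : KP.Times) (x : ℝ) (ψ : ℝ → KP.Vec m), Continuous ψ →
        ∀ φ : KP.HalfL2 m, ((φ : ℝ → KP.Vec m) =ᵐ[KP.halfLine] fun ζ => ψ (ζ + x)) →
        ∃ u : ℝ → KP.Vec m, ContinuousOn u (Iic 0) ∧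
          ((KP.resolventOp (P x t) φ : ℝ → KP.Vec m) =ᵐ[KP.halfLine] u) ∧
          KP.gaugeOperator (fun x' ξ => kminus x' ξ t) ψ x = u 0) := by
  have h : ∀ x t, KP.IsRegularSlice fun z ζ => p (z + x) (ζ + x) t := hp.isRegularSlice
  have hbr : ∀ x t, KP.IsBracket (G x t) ((h x t).glmKernel (P x t)) := fun x t =>
    ⟨((h x t).continuous_glmKernel (P x t)).continuousOn,
      (h x t).hasKernel_glmKernel (hP x t) (hinv x t) (hG x t)⟩
  have hsmooth : ∀ x t z, ContDiff ℝ ∞ ((h x t).glmKernel (P x t) z) := fun x t =>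
    (h x t).contDiff_glmKernel (P x t)
  refine ⟨⟨fun z ζ x t => (h x t).glmKernel (P x t) z ζ, hbr⟩,
    ⟨fun x ξ t => (h x t).glmKernel (P x t) 0 (ξ - x),
      fun x ξ t => -(h x t).glmKernel (P x t) 0 (ξ - x), fun t => ⟨fun x => ?_, fun x => ?_,
        fun ψ hψ x => ?_⟩⟩, fun g hg kminus kplus hF => ?_⟩
  · have hmp := KP.measurePreserving_add_Iic (-x) x
    rw [add_neg_cancel] at hmp
    exact ((h x t).memLp_glmKernel_row (P x t) 0).comp_measurePreserving hmp
  · have hc := (hsmooth x t 0).continuous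
    have hc' : Continuous fun ξ => -(h x t).glmKernel (P x t) 0 (ξ - x) := by fun_prop
    exact hc'.locallyIntegrable.locallyIntegrableOn _
  · exact KP.factorization_glmKernel (h x t) (hP x t) (hinv x t) (fun s => rfl) (fun s => rfl) hψ
  -- An arbitrary `g` is known only on the closed quadrant; there it agrees with `glmKernel`, smooth
  -- across `ζ = 0`. Hence the one-sided derivatives of `g` at `0` are ordinary derivatives of
  -- `glmKernel`.
  have hgeq : ∀ x t, ∀ z ≤ 0, EqOn (fun ζ => g z ζ x t) ((h x t).glmKernel (P x t) z) (Iic 0) :=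
    fun x t z hz ζ hζ => (hg x t).eq (hbr x t) hz hζ
  have hgauge : ∀ x t (ψ : ℝ → KP.Vec m) (φ : KP.HalfL2 m),
      (φ =ᵐ[KP.halfLine] fun s => ψ (s + x)) →
      KP.gaugeOperator (fun x' ξ => kminus x' ξ t) ψ x =
        ψ x + (h x t).resolventRow (P x t) 0 φ := fun x t ψ φ hφ =>
    (hF t).gaugeOperator_eq (h x t) (hP x t) (hinv x t) hφ
  refine ⟨fun x t z hz => ((hsmooth x t z).contDiffOn).congr (hgeq x t z hz), fun w => ?_,
    fun t x ψ hψ φ hφ => ?_⟩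
  · have hderiv : ∀ j x t, KP.rightDeriv j (fun z ζ => g z ζ x t) 0 0 =
        iteratedDeriv j (fun ξ => (h x t).glmKernel (P x t) 0 (ξ - x)) x := by
      intro j x t
      rw [KP.rightDeriv, iteratedDerivWithin_congr (hgeq x t 0 le_rfl) self_mem_Iic,
        iteratedDerivWithin_eq_iteratedDeriv (uniqueDiffOn_Iic 0)
          ((hsmooth x t 0).of_le (by exact_mod_cast le_top)).contDiffAt self_mem_Iic,
        iteratedDeriv_comp_sub_const]
      simp
    -- The given `kminus` need not be smooth, but on test functions `W` acts through the smooth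
    -- kernel `glmKernel`, to which the expansion applies.
    have hiff : ∀ t, KP.HasGaugeExpansion (KP.gaugeOperator fun x ξ => kminus x ξ t)
        (fun k x => w k x t) ↔ _ := fun t =>
      KP.hasGaugeExpansion_iff (K := fun x ξ => (h x t).glmKernel (P x t) 0 (ξ - x))
        (fun x => (hsmooth x t 0).comp (contDiff_id.sub contDiff_const)) (fun ψ hψ x => by
          have hL := (hψ.comp_add_const x).memLp KP.halfLine
          rw [hgauge x t ψ hL.toLp hL.coeFn_toLp,
            (h x t).resolventRow_apply (hP x t) (hinv x t), KP.setIntegral_Iic_eq_shift _ x]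
          refine congrArg _ (integral_congr_ae ?_)
          filter_upwards [hL.coeFn_toLp] with s hs
          rw [hs, add_sub_cancel_right]) _
    simp only [hiff, hderiv]
    exact ⟨fun H k hk x t => H t k hk x, fun H t k hk x => H k hk x t⟩
  · refine ⟨fun z => ψ (z + x) + (h x t).resolventRow (P x t) z φ, ?_,
      (h x t).resolventOp_ae_eq (hP x t) (hinv x t) hφ, ?_⟩
    · have hc := (h x t).continuous_resolventRow_apply (P x t) φ
      exact Continuous.continuousOn (by fun_prop)
    · simp only [hgauge x t ψ φ hφ, zero_add]
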